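/- Let $d\ge 0$ be an integer, $\alpha>-1/2$, and write $\mathbb{R}^{d+1}_+=\mathbb{R}^d\times(0,\infty)$, with points $x=(x',x_{d+1})$. Equip it with the measure $$d\mu_\alpha(x)=\frac{x_{d+1}^{2\alpha+1}}{(2\pi)^{d/2}\,2^{\alpha}\,\Gamma(\alpha+1)}\,dx ,$$ and let $L^p_\alpha=L^p(\mathbb{R}^{d+1}_+,\mu_\alpha)$ (complex-valued functions), with norm $\|\cdot\|_{\alpha,p}$. The Weinstein transform of $f\in L^1_\alpha$ is $$\mathcal{F}_{W,\alpha}(f)(\lambda)=\int_{\mathbb{R}^{d+1}_+} f(x)\,e^{-i\langle x',\lambda'\rangle}\,j_\alpha(x_{d+1}\lambda_{d+1})\,d\mu_\alpha(x),\qquad j_\alpha(t)=\Gamma(\alpha+1)\sum_{k=0}^\infty\frac{(-1)^k t^{2k}}{2^{2k}\,k!\,\Gamma(\alpha+k+1)} ,$$ and for $1\le p\le 2$ it is extended by continuity from $L^1_\alpha\cap L^p_\alpha$ to a bounded operator $L^p_\alpha\to L^q_\alpha$, where $q=p/(p-1)$ ($q=\infty$ if $p=1$). Let $1\le p\le 2$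 and let $\Omega,\Sigma\subseteq\mathbb{R}^{d+1}_+$ be measurable. A function $\psi\in L^p_\alpha$ is bandlimited to $\Sigma$ if $Q_\Sigma\psi=\psi$, where $Q_\Sigma$ is defined by $\mathcal{F}_{W,\alpha}(Q_\Sigma\psi)=\chi_\Sigma\,\mathcal{F}_{W,\alpha}(\psi)$. Let $\varphi\in L^p_\alpha$, $\varphi\neq 0$, and let $\varepsilon_\Omega,\varepsilon_\Sigma$ be real numbers such that $\varphi$ is $\varepsilon_\Omega$-concentrated to $\Omega$ in $L^p_\alpha$-norm, i.e. $\|\varphi-\chi_\Omega\varphi\|_{\alpha,p}\le\varepsilon_\Omega\|\varphi\|_{\alpha,p}$, and $\varepsilon_\Sigma$-bandlimited to $\Sigma$ in $L^p_\alpha$-norm, i.e. there is $\psi\in L^p_\alpha$ bandlimited to $\Sigma$ with $\|\varphi-\psi\|_{\alpha,p}\le\varepsilon_\Sigma\|\varphi\|_{\alpha,p}$. Then $$1-\varepsilon_\Omega-\varepsilon_\Sigma\;\le\;(1+\varepsilon_\Sigma)\,\mu_\alpha(\Sigma)^{1/p}\,\mu_\alpha(\Omega)^{1/p},$$ where the measures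 may be infinite and $0\cdot\infty=0$. -/

import Mathlib

open MeasureTheory Filter Topology
open scoped ENNReal

noncomputable section

namespace Weinstein

/-- The ambient space `ℝ^d × ℝ`; a point is `x = (x', x_{d+1})`. -/
abbrev Space (d : ℕ) : Type := EuclideanSpace ℝ (Fin d) × ℝ

/-- The half-space `ℝ^{d+1}_+ = ℝ^d × (0, ∞)`. -/
def halfSpace (d : ℕ) : Set (Space d) := {x | 0 < x.2}

/-- The measure `μ_α` on `ℝ^d × (0, ∞)`, of density
`x_{d+1}^{2α+1} / ((2π)^{d/2} 2^α Γ(α+1))`. This is the normalization for which the Weinstein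
transform is an isometry of `L²` and is inverted by the kernel with the opposite sign. -/
def mu (d : ℕ) (α : ℝ) : Measure (Space d) :=
  ((volume : Measure (Space d)).restrict (halfSpace d)).withDensity fun x =>
    ENNReal.ofReal
      (x.2 ^ (2 * α + 1) /
        ((2 * Real.pi) ^ ((d : ℝ) / 2) * (2 : ℝ) ^ α * Real.Gamma (α + 1)))

/-- The normalized Bessel function
`j_α(t) = Γ(α+1) ∑_k (-1)^k t^{2k} / (2^{2k} k! Γ(α+k+1))`, so that `j_α(0) = 1`. -/
def besselj (α t : ℝ) : ℝ :=
  Real.Gamma (α + 1) *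
    ∑' k : ℕ, (-1 : ℝ) ^ k * t ^ (2 * k) /
      ((2 : ℝ) ^ (2 * k) * (Nat.factorial k : ℝ) * Real.Gamma (α + k + 1))

/-- The Weinstein kernel `Λ(x, y) = exp(-i⟨x', y'⟩) j_α(x_{d+1} y_{d+1})`. -/
def kernel (d : ℕ) (α : ℝ) (x y : Space d) : ℂ :=
  Complex.exp (-Complex.I * ((inner ℝ x.1 y.1 : ℝ) : ℂ)) * ((besselj α (x.2 * y.2) : ℝ) : ℂ)

/-- The Weinstein transform of an integrable function, as an integral. -/
def transform (d : ℕ) (α : ℝ) (f : Space d → ℂ) (y : Space d) : ℂ :=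
  ∫ x, f x * kernel d α x y ∂(mu d α)

/-- `g` is (a representative of) the Weinstein transform of `f ∈ L^p_α`, `1 ≤ p ≤ 2`: the value at
`f` of the extension by continuity, from `L¹_α ∩ L^p_α` to `L^p_α`, of the integral transform
regarded as an operator into `L^q_α`, where `q = p / (p - 1)` (and `q = ∞` when `p = 1`). -/
def IsTransform (d : ℕ) (α : ℝ) (p : ℝ≥0∞) (f g : Space d → ℂ) : Prop :=
  MemLp f p (mu d α) ∧ MemLp g (ENNReal.conjExponent p) (mu d α) ∧
    ∃ u : ℕ → Space d → ℂ,
      (∀ n, MemLp (u n) 1 (mu d α) ∧ MemLp (u n) p (mu d α)) ∧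
      Tendsto (fun n => eLpNorm (u n - f) p (mu d α)) atTop (𝓝 0) ∧
      Tendsto (fun n => eLpNorm (transform d α (u n) - g) (ENNReal.conjExponent p) (mu d α))
        atTop (𝓝 0)

/-- `Q_S f = h` in `L^p_α`: the function `h` is the one whose Weinstein transform is the
transform of `f` multiplied by the characteristic function of `S`. -/
def IsBandOperator (d : ℕ) (α : ℝ) (p : ℝ≥0∞) (S : Set (Space d)) (f h : Space d → ℂ) : Prop :=
  ∃ g : Space d → ℂ, IsTransform d α p f g ∧ IsTransform d α p h (S.indicator g)

/-- `ψ ∈ L^p_α` is bandlimited to `S`: `Q_S ψ = ψ`. -/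
def IsBandlimited (d : ℕ) (α : ℝ) (p : ℝ≥0∞) (S : Set (Space d)) (ψ : Space d → ℂ) : Prop :=
  IsBandOperator d α p S ψ ψ

/-- The norm of `L^p_α` (used only for functions that belong to `L^p_α`). -/
def norm (d : ℕ) (α : ℝ) (p : ℝ≥0∞) (f : Space d → ℂ) : ℝ :=
  (eLpNorm f p (mu d α)).toReal

/-- The time-limiting operator `P_S φ = φ χ_S`. -/
def timeLimit (d : ℕ) (S : Set (Space d)) (φ : Space d → ℂ) : Space d → ℂ :=
  S.indicator φ

/-- `φ` is `ε`-concentrated to `S` in `L^p_α`-norm. -/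
def IsConcentrated (d : ℕ) (α : ℝ) (p : ℝ≥0∞) (S : Set (Space d)) (ε : ℝ)
    (φ : Space d → ℂ) : Prop :=
  norm d α p (φ - timeLimit d S φ) ≤ ε * norm d α p φ

/-- `φ` is `ε`-bandlimited to `S` in `L^p_α`-norm. -/
def IsEpsBandlimited (d : ℕ) (α : ℝ) (p : ℝ≥0∞) (S : Set (Space d)) (ε : ℝ)
    (φ : Space d → ℂ) : Prop :=
  ∃ ψ : Space d → ℂ, IsBandlimited d α p S ψ ∧ norm d α p (φ - ψ) ≤ ε * norm d α p φ

end Weinstein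

end

/-!
A function `ψ` bandlimited to `S` is bounded by `μ(S)^{1/p} ‖ψ‖_p` almost everywhere; hence
`‖χ_Ω ψ‖_p ≤ μ(S)^{1/p} μ(Ω)^{1/p} ‖ψ‖_p`, and the theorem is the triangle inequality for
`φ = (φ - χ_Ω φ) + χ_Ω (φ - ψ) + χ_Ω ψ` together with `‖ψ‖_p ≤ (1 + ε_S) ‖φ‖_p`.

The sup bound would follow from the Hausdorff–Young inequality and inversion. Complex interpolation
can be avoided: by inversion `ψ(x)` is the integral of the transform of `ψ` against
`k_x = χ_S conj Λ(·, x)`, and by the multiplication formula this is the integral of `ψ` against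
`F k_x`. Since `|k_x| ≤ χ_S`, the function `F k_x` is bounded by `μ(S)` and has `L²`-norm at most
`μ(S)^{1/2}`, so its `L^q`-norm is at most `μ(S)^{1/p}` by the elementary log-convexity of Lebesgue
norms (`eLpNorm_transform_indicator_le`, `IsTransform.ae_enorm_le`).

What is needed of the Weinstein transform is therefore the bound `|Λ| ≤ 1`, the `L²` bound, and
inversion for functions whose transform is integrable. The first is the Poisson integral, which
writes `j_α` as an average of cosines over a beta distribution. The other two rest on an explicit
family of Gaussians, `testFun`, whose transforms and double transforms are computed directly
(`transform_testFun`, `transform_testDual`), and which is total: a function orthogonal to all of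
them vanishes almost everywhere (`ae_eq_zero_of_integral_mul_testFun`), because divided by a fixed
Gaussian they form a star-closed multiplicative family that separates the points of the closed
half-space. Functions satisfying the inversion formula are mapped isometrically in `L²`, and they
are dense since they contain the Gaussians; this gives the `L²` bound. Inversion holds weakly
against every Gaussian by the multiplication formula, hence almost everywhere.
-/

open MeasureTheory Filter Topology Set
open scoped ENNReal

noncomputable section

namespace Weinstein

variable {d : ℕ} {α : ℝ}

/-! ### The normalized Bessel function -/

section Bessel

open ProbabilityTheory

lemma toReal_betaPDF {a b : ℝ} (ha : 0 < a) (hb : 0 < b) (u : ℝ) :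
    (betaPDF a b u).toReal = betaPDFReal a b u := by
  refine ENNReal.toReal_ofReal ?_
  by_cases h : 0 < u ∧ u < 1
  · exact (betaPDFReal_pos h.1 h.2 ha hb).le
  · simp [betaPDFReal, h]

lemma measurable_betaPDF (a b : ℝ) : Measurable (betaPDF a b) :=
  (measurable_betaPDFReal a b).ennreal_ofReal

lemma integral_betaPDFReal {a b : ℝ} (ha : 0 < a) (hb : 0 < b) :
    ∫ u, betaPDFReal a b u = 1 := by
  simp_rw [← toReal_betaPDF ha hb]
  rw [integral_toReal (measurable_betaPDF a b).aemeasurable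
    (Eventually.of_forall fun u => ENNReal.ofReal_lt_top), lintegral_betaPDF_eq_one ha hb]
  simp

/-- The moments of the beta distribution. -/
lemma integral_pow_betaMeasure {a b : ℝ} (ha : 0 < a) (hb : 0 < b) (k : ℕ) :
    ∫ u, u ^ k ∂(betaMeasure a b) = beta (a + k) b / beta a b := by
  have hak : 0 < a + k := by positivity
  rw [betaMeasure, integral_withDensity_eq_integral_toReal_smul (measurable_betaPDF a b)
    (Eventually.of_forall fun u => ENNReal.ofReal_lt_top)]
  have h (u : ℝ) : (betaPDF a b u).toReal • u ^ k =
      beta (a + k) b / beta a b * betaPDFReal (a + k) b u := by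
    rw [toReal_betaPDF ha hb, smul_eq_mul]
    unfold betaPDFReal
    split_ifs with hu
    · have h1 := (beta_pos ha hb).ne'
      have h2 := (beta_pos hak hb).ne'
      have h3 : u ^ (a + k - 1) = u ^ (a - 1) * u ^ k := by
        rw [← Real.rpow_add_natCast hu.1.ne']; congr 1; ring
      rw [h3]; field_simp
    · simp
  simp_rw [h]
  rw [integral_const_mul, integral_betaPDFReal hak hb, mul_one]

lemma ae_mem_Ioo_betaMeasure (a b : ℝ) : ∀ᵐ u ∂(betaMeasure a b), u ∈ Ioo (0 : ℝ) 1 := by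
  rw [betaMeasure, ae_withDensity_iff (measurable_betaPDF a b)]
  refine Eventually.of_forall fun u hu => ?_
  by_contra h
  exact hu (by simp [betaPDF, betaPDFReal, show ¬ (0 < u ∧ u < 1) from h])

/-- The identity that turns the moments of the beta distribution into the coefficients of
`besselj`. -/
lemma gamma_nat_add_half_div_factorial (k : ℕ) :
    Real.Gamma (1 / 2 + k) / (Nat.factorial (2 * k) : ℝ) =
      Real.sqrt Real.pi / ((2 : ℝ) ^ (2 * k) * Nat.factorial k) := by
  rw [add_comm, Real.Gamma_nat_add_half]
  have h : ((2 * k).factorial : ℝ) =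
      2 ^ k * k.factorial * ((2 * k - 1 : ℕ).doubleFactorial : ℝ) := by
    rcases k with _ | k
    · simp
    · have h1 := Nat.factorial_eq_mul_doubleFactorial (2 * k + 1)
      have h2 := Nat.doubleFactorial_two_mul (k + 1)
      rw [show 2 * (k + 1) = 2 * k + 1 + 1 by ring] at h2 ⊢
      rw [h1, h2]
      push_cast
      simp
  rw [h]
  have : ((2 * k - 1 : ℕ).doubleFactorial : ℝ) ≠ 0 := by
    exact_mod_cast (Nat.doubleFactorial_pos _).ne'
  have := Nat.factorial_ne_zero k
  field_simp
  ring

/-- The power series of `besselj` converges to the Poisson integral: the expectation of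
`cos (t √u)` for `u` distributed by the beta law with parameters `1 / 2` and `α + 1 / 2`. -/
lemma hasSum_besselj {α : ℝ} (hα : -(1 / 2 : ℝ) < α) (t : ℝ) :
    HasSum (fun k : ℕ => Real.Gamma (α + 1) * ((-1 : ℝ) ^ k * t ^ (2 * k) /
      ((2 : ℝ) ^ (2 * k) * (Nat.factorial k : ℝ) * Real.Gamma (α + k + 1))))
      (∫ u, Real.cos (t * Real.sqrt u) ∂(betaMeasure (1 / 2) (α + 1 / 2))) := by
  have hb : 0 < α + 1 / 2 := by linarith
  have ha : (0 : ℝ) < 1 / 2 := by norm_num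
  have := isProbabilityMeasureBeta ha hb
  set β := betaMeasure (1 / 2) (α + 1 / 2) with hβ
  let F : ℕ → ℝ → ℝ := fun k u => (-1) ^ k * t ^ (2 * k) / (2 * k).factorial * u ^ k
  -- the `F k` are the Taylor terms of `cos (t √u)`; on `[0, 1]` they have summable bounds
  have hbound (k : ℕ) : ∀ᵐ u ∂β, ‖F k u‖ ≤ |t| ^ (2 * k) / (2 * k).factorial := by
    filter_upwards [ae_mem_Ioo_betaMeasure (1 / 2) (α + 1 / 2)] with u hu
    simp only [F, norm_mul, norm_div, norm_pow, Real.norm_eq_abs, abs_neg, abs_one, one_pow,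
      one_mul, Nat.abs_cast]
    refine mul_le_of_le_one_right (by positivity) (pow_le_one₀ (abs_nonneg _) ?_)
    rw [abs_of_pos hu.1]; exact hu.2.le
  have hint (k : ℕ) : Integrable (F k) β :=
    Integrable.mono' (integrable_const _)
      (by simp only [F]; exact (by fun_prop : Measurable _).aestronglyMeasurable) (hbound k)
  have hsum : Summable fun k => ∫ u, ‖F k u‖ ∂β := by
    refine Summable.of_nonneg_of_le (fun k => integral_nonneg fun u => norm_nonneg _)
      (fun k => ?_) ((Real.summable_pow_div_factorial |t|).comp_injective
        (fun a b h => by simpa using h : Function.Injective fun k : ℕ => 2 * k))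
    calc ∫ u, ‖F k u‖ ∂β ≤ ∫ _, |t| ^ (2 * k) / (2 * k).factorial ∂β :=
          integral_mono_ae (hint k).norm (integrable_const _) (hbound k)
      _ = _ := by simp
  have key := hasSum_integral_of_summable_integral_norm hint hsum
  have hcos : ∫ u, ∑' k, F k u ∂β = ∫ u, Real.cos (t * Real.sqrt u) ∂β := by
    refine integral_congr_ae ?_
    filter_upwards [ae_mem_Ioo_betaMeasure (1 / 2) (α + 1 / 2)] with u hu
    rw [← (Real.hasSum_cos (t * Real.sqrt u)).tsum_eq]
    refine tsum_congr fun k => ?_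
    simp only [F]
    rw [mul_pow, pow_mul (Real.sqrt u), Real.sq_sqrt hu.1.le]
    ring
  rw [hcos] at key
  refine (congrArg (HasSum · _) (funext fun k => ?_)).mpr key
  change _ = ∫ u, (-1) ^ k * t ^ (2 * k) / (2 * k).factorial * u ^ k ∂β
  rw [integral_const_mul, integral_pow_betaMeasure ha hb, beta, beta,
    show (1 / 2 : ℝ) + k + (α + 1 / 2) = α + k + 1 by ring,
    show (1 / 2 : ℝ) + (α + 1 / 2) = α + 1 by ring]
  have h1 : Real.Gamma (α + 1 / 2) ≠ 0 := (Real.Gamma_pos_of_pos hb).ne'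
  have h2 : Real.Gamma (α + 1) ≠ 0 := (Real.Gamma_pos_of_pos (by linarith)).ne'
  have h3 : Real.Gamma (α + k + 1) ≠ 0 :=
    (Real.Gamma_pos_of_pos (by have := k.cast_nonneg (α := ℝ); linarith)).ne'
  have h4 := gamma_nat_add_half_div_factorial k
  have h5 : Real.sqrt Real.pi ≠ 0 := by positivity
  have h6 : ((2 * k).factorial : ℝ) ≠ 0 := by positivity
  have h7 : (k.factorial : ℝ) ≠ 0 := by positivity
  rw [div_eq_div_iff h6 (by positivity)] at h4
  rw [Real.Gamma_one_half_eq]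
  generalize Real.Gamma (1 / 2 + (k : ℝ)) = g at h4 ⊢
  generalize Real.Gamma (α + 1 / 2) = g₁ at h1 ⊢
  field_simp
  linear_combination -(t ^ (2 * k)) * h4

lemma besselj_eq_integral {α : ℝ} (hα : -(1 / 2 : ℝ) < α) (t : ℝ) :
    besselj α t = ∫ u, Real.cos (t * Real.sqrt u) ∂(betaMeasure (1 / 2) (α + 1 / 2)) := by
  rw [← (hasSum_besselj hα t).tsum_eq, tsum_mul_left, besselj]

lemma abs_besselj_le_one {α : ℝ} (hα : -(1 / 2 : ℝ) < α) (t : ℝ) : |besselj α t| ≤ 1 := by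
  have := isProbabilityMeasureBeta (by norm_num : (0 : ℝ) < 1 / 2)
    (by linarith : 0 < α + 1 / 2)
  rw [besselj_eq_integral hα, ← Real.norm_eq_abs]
  refine (norm_integral_le_of_norm_le_const (C := 1)
    (Eventually.of_forall fun u => Real.abs_cos_le_one _)).trans ?_
  rw [probReal_univ, one_mul]

lemma continuous_besselj {α : ℝ} (hα : -(1 / 2 : ℝ) < α) : Continuous (besselj α) := by
  have := isProbabilityMeasureBeta (by norm_num : (0 : ℝ) < 1 / 2)
    (by linarith : 0 < α + 1 / 2)
  rw [show besselj α = _ from funext (besselj_eq_integral hα)]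
  refine continuous_of_dominated (bound := fun _ => 1) (fun t => ?_) (fun t => ?_)
    (integrable_const _) ?_
  · exact (by fun_prop : Measurable _).aestronglyMeasurable
  · exact Eventually.of_forall fun u => Real.abs_cos_le_one _
  · exact Eventually.of_forall fun u => by fun_prop

/-- The Hankel transform of a centred Gaussian is a centred Gaussian: the series of `besselj` is
integrated term by term. -/
lemma integral_gaussian_mul_besselj {α : ℝ} (hα : -(1 / 2 : ℝ) < α) {s : ℝ} (hs : 0 < s)
    (l : ℝ) :
    ∫ t in Ioi (0 : ℝ), t ^ (2 * α + 1) * (Real.exp (-s * t ^ 2) * besselj α (t * l)) =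
      Real.Gamma (α + 1) / (2 * s ^ (α + 1)) * Real.exp (-l ^ 2 / (4 * s)) := by
  let c : ℕ → ℝ := fun k => Real.Gamma (α + 1) * ((-1 : ℝ) ^ k * l ^ (2 * k) /
      ((2 : ℝ) ^ (2 * k) * (Nat.factorial k : ℝ) * Real.Gamma (α + k + 1)))
  let G : ℕ → ℝ → ℝ := fun k t => t ^ (2 * α + 1 + 2 * k) * Real.exp (-s * t ^ 2)
  have hGam (k : ℕ) : 0 < Real.Gamma (α + k + 1) :=
    Real.Gamma_pos_of_pos (by have := k.cast_nonneg (α := ℝ); linarith)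
  have hq (k : ℕ) : -1 < 2 * α + 1 + 2 * k := by
    have := k.cast_nonneg (α := ℝ); linarith
  have hGint (k : ℕ) : Integrable (G k) (volume.restrict (Ioi 0)) :=
    integrableOn_rpow_mul_exp_neg_mul_sq hs (hq k)
  have hGval (k : ℕ) : ∫ t in Ioi (0 : ℝ), G k t =
      Real.Gamma (α + k + 1) / (2 * s ^ (α + 1) * s ^ k) := by
    have h := integral_rpow_mul_exp_neg_mul_rpow (p := 2) (by norm_num) (hq k) hs
    simp only [Real.rpow_two] at h
    simp only [G]
    rw [h, show (2 * α + 1 + 2 * k + 1) / 2 = α + k + 1 by ring,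
      show -(2 * α + 1 + 2 * k + 1) / 2 = -(α + 1 + k) by ring, Real.rpow_neg hs.le,
      Real.rpow_add_natCast hs.ne']
    field_simp
  -- the Gamma factor of the Gaussian moment cancels the one in the series of `besselj`,
  -- and an exponential series remains
  have hcG (k : ℕ) : c k * ∫ t in Ioi (0 : ℝ), G k t =
      Real.Gamma (α + 1) / (2 * s ^ (α + 1)) * ((-l ^ 2 / (4 * s)) ^ k / k.factorial) := by
    rw [hGval]
    have := (hGam k).ne'
    have : (k.factorial : ℝ) ≠ 0 := by positivity
    have : s ^ (α + 1) ≠ 0 := by positivity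
    have h4 : (2 : ℝ) ^ (2 * k) = 4 ^ k := by rw [pow_mul]; norm_num
    simp only [c]
    rw [h4, div_pow, mul_pow, neg_pow (l ^ 2), ← pow_mul]
    field_simp
  have hnorm (k : ℕ) : ∫ t in Ioi (0 : ℝ), ‖c k * G k t‖ = ‖c k * ∫ t in Ioi (0 : ℝ), G k t‖ := by
    simp_rw [norm_mul]
    rw [integral_const_mul]
    congr 1
    rw [Real.norm_of_nonneg (by rw [hGval]; have := hGam k; positivity)]
    refine setIntegral_congr_fun measurableSet_Ioi fun t ht => ?_
    exact Real.norm_of_nonneg (mul_nonneg (Real.rpow_nonneg (le_of_lt ht) _) (Real.exp_pos _).le)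
  have hexp : HasSum (fun k : ℕ => (-l ^ 2 / (4 * s)) ^ k / (k.factorial : ℝ))
      (Real.exp (-l ^ 2 / (4 * s))) := by
    rw [Real.exp_eq_exp_ℝ]; exact NormedSpace.expSeries_div_hasSum_exp _
  have key := hasSum_integral_of_summable_integral_norm
    (μ := volume.restrict (Ioi (0 : ℝ))) (F := fun k t => c k * G k t)
    (fun k => (hGint k).const_mul _) (by
      simp_rw [hnorm, hcG]
      exact (hexp.summable.mul_left _).norm)
  simp_rw [integral_const_mul, hcG] at key
  refine Eq.trans ?_ (key.unique (hexp.mul_left _))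
  refine setIntegral_congr_fun measurableSet_Ioi fun t ht => ?_
  have ht : 0 < t := ht
  rw [besselj_eq_integral hα, ← (hasSum_besselj hα (t * l)).tsum_eq, ← tsum_mul_left,
    ← tsum_mul_left]
  refine tsum_congr fun k => ?_
  simp only [c, G]
  rw [show (2 * α + 1 + 2 * (k : ℝ)) = 2 * α + 1 + (2 * k : ℕ) by push_cast; ring,
    Real.rpow_add_natCast ht.ne', mul_pow]
  ring

end Bessel

/-! ### Transforms of Gaussians -/

/-- The factor of `mu` on the half-line `(0, ∞)`; the whole normalizing constant of `mu` is put
into it. -/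
def radialMeasure (d : ℕ) (α : ℝ) : Measure ℝ :=
  (volume.restrict (Ioi 0)).withDensity fun t => ENNReal.ofReal (t ^ (2 * α + 1) /
        ((2 * Real.pi) ^ ((d : ℝ) / 2) * (2 : ℝ) ^ α * Real.Gamma (α + 1)))

instance (d : ℕ) (α : ℝ) : SFinite (radialMeasure d α) := by
  unfold radialMeasure; infer_instance

instance (d : ℕ) (α : ℝ) : SFinite (mu d α) := by
  unfold mu; infer_instance

lemma measurable_radialDensity (d : ℕ) (α : ℝ) :
    Measurable fun t : ℝ => ENNReal.ofReal (t ^ (2 * α + 1) /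
        ((2 * Real.pi) ^ ((d : ℝ) / 2) * (2 : ℝ) ^ α * Real.Gamma (α + 1))) := by
  fun_prop

lemma mu_eq_prod (d : ℕ) (α : ℝ) : mu d α = volume.prod (radialMeasure d α) := by
  rw [radialMeasure, prod_withDensity_right (measurable_radialDensity d α), mu,
    show halfSpace d = univ ×ˢ Ioi 0 by ext; simp [halfSpace], Measure.volume_eq_prod,
    ← Measure.prod_restrict, Measure.restrict_univ]

/-- `mu` does not see the complement of the open half-space. -/
lemma ae_mem_halfSpace (d : ℕ) (α : ℝ) : ∀ᵐ x ∂(mu d α), 0 < x.2 := by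
  refine (withDensity_absolutelyContinuous _ _).ae_le ?_
  exact ae_restrict_mem (measurableSet_lt measurable_const measurable_snd)

lemma radialConst_pos (d : ℕ) (hα : -(1 / 2 : ℝ) < α) :
    0 < (2 * Real.pi) ^ ((d : ℝ) / 2) * (2 : ℝ) ^ α * Real.Gamma (α + 1) := by
  have := Real.Gamma_pos_of_pos (show 0 < α + 1 by linarith)
  positivity

lemma integral_radialMeasure (hα : -(1 / 2 : ℝ) < α) (g : ℝ → ℂ) :
    ∫ t, g t ∂(radialMeasure d α) = ∫ t in Ioi (0 : ℝ), ((t ^ (2 * α + 1) /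
        ((2 * Real.pi) ^ ((d : ℝ) / 2) * (2 : ℝ) ^ α * Real.Gamma (α + 1)) : ℝ) : ℂ) * g t := by
  rw [radialMeasure, integral_withDensity_eq_integral_toReal_smul (measurable_radialDensity d α)
    (Eventually.of_forall fun _ => ENNReal.ofReal_lt_top)]
  refine setIntegral_congr_fun measurableSet_Ioi fun t ht => ?_
  have := radialConst_pos d hα
  have ht : 0 < t := ht
  rw [ENNReal.toReal_ofReal (by positivity), Complex.real_smul]

lemma integrable_gaussian_radialMeasure (hα : -(1 / 2 : ℝ) < α) {s : ℝ} (hs : 0 < s) :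
    Integrable (fun t : ℝ => (Real.exp (-s * t ^ 2) : ℂ)) (radialMeasure d α) := by
  suffices h : Integrable (fun t : ℝ => Real.exp (-s * t ^ 2)) (radialMeasure d α) from h.ofReal
  rw [radialMeasure, integrable_withDensity_iff (measurable_radialDensity d α)
    (Eventually.of_forall fun _ => ENNReal.ofReal_lt_top)]
  have h := (integrableOn_rpow_mul_exp_neg_mul_sq hs (by linarith : -1 < 2 * α + 1)).const_mul
    ((2 * Real.pi) ^ ((d : ℝ) / 2) * (2 : ℝ) ^ α * Real.Gamma (α + 1))⁻¹
  refine IntegrableOn.congr_fun h (fun t ht => ?_) measurableSet_Ioi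
  have := radialConst_pos d hα
  have ht : 0 < t := ht
  rw [ENNReal.toReal_ofReal (by positivity)]
  ring

lemma integrable_mul_gaussian (hα : -(1 / 2 : ℝ) < α) {s : ℝ} (hs : 0 < s)
    {f : EuclideanSpace ℝ (Fin d) → ℂ} (hf : Integrable f) :
    Integrable (fun x : Space d => f x.1 * (Real.exp (-s * x.2 ^ 2) : ℂ)) (mu d α) := by
  rw [mu_eq_prod]
  exact hf.mul_prod (integrable_gaussian_radialMeasure hα hs)

/-- The Weinstein transform of the product of a function of `x'` and a Gaussian in `x_{d+1}`. -/
lemma transform_mul_gaussian (hα : -(1 / 2 : ℝ) < α) {s : ℝ} (hs : 0 < s)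
    (f : EuclideanSpace ℝ (Fin d) → ℂ) (y : Space d) :
    transform d α (fun x => f x.1 * (Real.exp (-s * x.2 ^ 2) : ℂ)) y =
      (∫ x, f x * Complex.exp (-Complex.I * ((inner ℝ x y.1 : ℝ) : ℂ))) *
        (((2 * Real.pi) ^ ((d : ℝ) / 2))⁻¹ * (2 * s) ^ (-(α + 1)) *
          Real.exp (-y.2 ^ 2 / (4 * s)) : ℝ) := by
  have h (x : Space d) : f x.1 * (Real.exp (-s * x.2 ^ 2) : ℂ) * kernel d α x y =
      (f x.1 * Complex.exp (-Complex.I * ((inner ℝ x.1 y.1 : ℝ) : ℂ))) *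
        ((Real.exp (-s * x.2 ^ 2) * besselj α (x.2 * y.2) : ℝ) : ℂ) := by
    rw [kernel]; push_cast; ring
  rw [transform]
  simp_rw [h]
  rw [mu_eq_prod, integral_prod_mul
    (fun x => f x * Complex.exp (-Complex.I * ((inner ℝ x y.1 : ℝ) : ℂ)))
    (fun t => ((Real.exp (-s * t ^ 2) * besselj α (t * y.2) : ℝ) : ℂ)),
    integral_radialMeasure hα]
  congr 1
  simp_rw [← Complex.ofReal_mul]
  rw [integral_complex_ofReal]
  congr 1
  simp_rw [div_mul_eq_mul_div]
  rw [integral_div, integral_gaussian_mul_besselj hα hs]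
  have h2 : (2 : ℝ) ^ (α + 1) = 2 ^ α * 2 := by rw [Real.rpow_add_one two_ne_zero]
  rw [Real.rpow_neg (by positivity), Real.mul_rpow zero_le_two hs.le, h2]
  have h1 := (Real.Gamma_pos_of_pos (show 0 < α + 1 by linarith)).ne'
  field_simp

/-- The test functions `exp (-|x'|² / 2 + i⟨a, x'⟩ - s x_{d+1}²)`. -/
def testFun (a : EuclideanSpace ℝ (Fin d)) (s : ℝ) (x : Space d) : ℂ :=
  Complex.exp (-(1 / 2 : ℂ) * (‖x.1‖ : ℂ) ^ 2 + Complex.I * ((inner ℝ a x.1 : ℝ) : ℂ)) *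
    (Real.exp (-s * x.2 ^ 2) : ℂ)

/-- The Weinstein transform of `testFun a s`; it is real-valued. -/
def testDual (α : ℝ) (a : EuclideanSpace ℝ (Fin d)) (s : ℝ) (y : Space d) : ℝ :=
  (2 * s) ^ (-(α + 1)) * Real.exp (-‖y.1 - a‖ ^ 2 / 2) * Real.exp (-(4 * s)⁻¹ * y.2 ^ 2)

lemma integral_euclidean_gaussian (w : EuclideanSpace ℝ (Fin d)) :
    ∫ x : EuclideanSpace ℝ (Fin d),
      Complex.exp (-(1 / 2 : ℂ) * (‖x‖ : ℂ) ^ 2 + Complex.I * ((inner ℝ w x : ℝ) : ℂ)) =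
      (((2 * Real.pi) ^ ((d : ℝ) / 2) * Real.exp (-‖w‖ ^ 2 / 2) : ℝ) : ℂ) := by
  rw [GaussianFourier.integral_cexp_neg_mul_sq_norm_add (by norm_num)]
  push_cast
  congr 1
  · rw [Complex.ofReal_cpow (by positivity)]
    push_cast
    rw [finrank_euclideanSpace, Fintype.card_fin]
    congr 1
    ring
  · rw [Complex.I_sq]
    congr 1
    ring

lemma transform_testFun (hα : -(1 / 2 : ℝ) < α) (a : EuclideanSpace ℝ (Fin d)) {s : ℝ}
    (hs : 0 < s) (y : Space d) :
    transform d α (testFun a s) y = testDual α a s y := by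
  unfold testFun
  rw [transform_mul_gaussian hα hs
    (fun x => Complex.exp (-(1 / 2 : ℂ) * (‖x‖ : ℂ) ^ 2 + Complex.I * ((inner ℝ a x : ℝ) : ℂ))) y]
  have h (x : EuclideanSpace ℝ (Fin d)) :
      Complex.exp (-(1 / 2 : ℂ) * (‖x‖ : ℂ) ^ 2 + Complex.I * ((inner ℝ a x : ℝ) : ℂ)) *
        Complex.exp (-Complex.I * ((inner ℝ x y.1 : ℝ) : ℂ)) =
      Complex.exp (-(1 / 2 : ℂ) * (‖x‖ : ℂ) ^ 2 +
        Complex.I * ((inner ℝ (a - y.1) x : ℝ) : ℂ)) := by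
    rw [← Complex.exp_add, inner_sub_left, real_inner_comm y.1 x]
    push_cast
    congr 1
    ring
  simp_rw [h]
  rw [integral_euclidean_gaussian, ← Complex.ofReal_mul, testDual, norm_sub_rev]
  congr 1
  have : ((2 * Real.pi) ^ ((d : ℝ) / 2)) ≠ 0 := by positivity
  rw [show -y.2 ^ 2 / (4 * s) = -(4 * s)⁻¹ * y.2 ^ 2 by ring]
  field_simp

/-- The transform of `testDual a s` is the conjugate of `testFun a s`. -/
lemma transform_testDual (hα : -(1 / 2 : ℝ) < α) (a : EuclideanSpace ℝ (Fin d)) {s : ℝ}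
    (hs : 0 < s) (y : Space d) :
    transform d α (fun x => (testDual α a s x : ℂ)) y = testFun (-a) s y := by
  have hs' : 0 < (4 * s)⁻¹ := by positivity
  have h0 : (fun x : Space d => (testDual α a s x : ℂ)) = fun x => (fun z =>
      (((2 * s) ^ (-(α + 1)) * Real.exp (-‖z - a‖ ^ 2 / 2) : ℝ) : ℂ)) x.1 *
        (Real.exp (-(4 * s)⁻¹ * x.2 ^ 2) : ℂ) := by
    funext x; rw [testDual, Complex.ofReal_mul]
  rw [h0, transform_mul_gaussian hα hs'
    (fun z => (((2 * s) ^ (-(α + 1)) * Real.exp (-‖z - a‖ ^ 2 / 2) : ℝ) : ℂ))]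
  rw [← integral_add_right_eq_self _ a]
  have h (x : EuclideanSpace ℝ (Fin d)) :
      (((2 * s) ^ (-(α + 1)) * Real.exp (-‖x + a - a‖ ^ 2 / 2) : ℝ) : ℂ) *
        Complex.exp (-Complex.I * ((inner ℝ (x + a) y.1 : ℝ) : ℂ)) =
      ((((2 * s) ^ (-(α + 1)) : ℝ) : ℂ) *
        Complex.exp (Complex.I * ((inner ℝ (-a) y.1 : ℝ) : ℂ))) *
      Complex.exp (-(1 / 2 : ℂ) * (‖x‖ : ℂ) ^ 2 +
        Complex.I * ((inner ℝ (-y.1) x : ℝ) : ℂ)) := by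
    rw [mul_assoc, ← Complex.exp_add, add_sub_cancel_right, inner_add_left, inner_neg_left,
      inner_neg_left, real_inner_comm y.1 x, Complex.ofReal_mul, mul_assoc, Complex.ofReal_exp,
      ← Complex.exp_add]
    push_cast
    congr 2
    ring
  simp_rw [h]
  rw [integral_const_mul, integral_euclidean_gaussian, testFun, Complex.exp_add, norm_neg]
  have e1 : Complex.exp (-(1 / 2 : ℂ) * (‖y.1‖ : ℂ) ^ 2) =
      ((Real.exp (-‖y.1‖ ^ 2 / 2) : ℝ) : ℂ) := by
    push_cast; congr 1; ring
  have e2 : (2 * (4 * s)⁻¹) ^ (-(α + 1)) = ((2 * s) ^ (-(α + 1)))⁻¹ := by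
    rw [show 2 * (4 * s)⁻¹ = (2 * s)⁻¹ by field_simp; norm_num, Real.inv_rpow (by positivity)]
  rw [e1, e2, show -y.2 ^ 2 / (4 * (4 * s)⁻¹) = -s * y.2 ^ 2 by field_simp]
  have h1 : (2 * s) ^ (-(α + 1)) ≠ 0 := by positivity
  have h2 : ((2 * Real.pi) ^ ((d : ℝ) / 2)) ≠ 0 := by positivity
  generalize (2 * s) ^ (-(α + 1)) = c at h1 ⊢
  generalize (2 * Real.pi) ^ ((d : ℝ) / 2) = c' at h2 ⊢
  have h1' : (c : ℂ) ≠ 0 := by exact_mod_cast h1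
  have h2' : (c' : ℂ) ≠ 0 := by exact_mod_cast h2
  simp only [Complex.ofReal_mul, Complex.ofReal_inv]
  field_simp

lemma integrable_testFun (hα : -(1 / 2 : ℝ) < α) (a : EuclideanSpace ℝ (Fin d)) {s : ℝ}
    (hs : 0 < s) : Integrable (testFun a s) (mu d α) := by
  have h : Integrable fun x : EuclideanSpace ℝ (Fin d) => Complex.exp
      (-(1 / 2 : ℂ) * (‖x‖ : ℂ) ^ 2 + Complex.I * ((inner ℝ a x : ℝ) : ℂ)) :=
    GaussianFourier.integrable_cexp_neg_mul_sq_norm_add (by norm_num) Complex.I a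
  have h' := integrable_mul_gaussian hα hs h
  exact h'

lemma integrable_testDual (hα : -(1 / 2 : ℝ) < α) (a : EuclideanSpace ℝ (Fin d)) {s : ℝ}
    (hs : 0 < s) : Integrable (fun x => (testDual α a s x : ℂ)) (mu d α) := by
  have hs' : 0 < (4 * s)⁻¹ := by positivity
  have h0 := ((GaussianFourier.integrable_cexp_neg_mul_sq_norm_add
    (V := EuclideanSpace ℝ (Fin d)) (b := 1 / 2) (by norm_num) 0 0).comp_sub_right a).const_mul
      (((2 * s) ^ (-(α + 1)) : ℝ) : ℂ)
  refine (integrable_mul_gaussian hα hs' h0).congr (Eventually.of_forall fun x => ?_)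
  simp only [testDual, zero_mul, add_zero]
  push_cast
  congr 3
  ring

lemma conj_testFun (a : EuclideanSpace ℝ (Fin d)) (s : ℝ) (x : Space d) :
    (starRingEnd ℂ) (testFun a s x) = testFun (-a) s x := by
  simp only [testFun, map_mul, ← Complex.exp_conj, Complex.conj_ofReal, map_add, map_neg,
    map_pow, Complex.conj_I, inner_neg_left]
  congr 2
  simp [map_ofNat (starRingEnd ℂ) 2]

lemma norm_testDual_le (α : ℝ) (a : EuclideanSpace ℝ (Fin d)) {s : ℝ} (hs : 0 < s)
    (x : Space d) : ‖(testDual α a s x : ℂ)‖ ≤ (2 * s) ^ (-(α + 1)) := by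
  rw [Complex.norm_of_nonneg (by unfold testDual; positivity), testDual, mul_assoc]
  refine mul_le_of_le_one_right (by positivity) (mul_le_one₀ (Real.exp_le_one_iff.mpr ?_)
    (Real.exp_pos _).le (Real.exp_le_one_iff.mpr ?_))
  · have := sq_nonneg ‖x.1 - a‖; linarith
  · have : 0 < (4 * s)⁻¹ := by positivity
    nlinarith [sq_nonneg x.2]

/-! ### Totality of the Gaussian test functions -/

/-- The functions `exp (i⟨a, x'⟩ - r x_{d+1}²)`, `r ≥ 0`, on the closed half-space. They are the
quotients of the test functions by a fixed Gaussian. -/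
def expFun (a : EuclideanSpace ℝ (Fin d)) (r : NNReal) :
    BoundedContinuousFunction (EuclideanSpace ℝ (Fin d) × NNReal) ℂ :=
  BoundedContinuousFunction.ofNormedAddCommGroup
    (fun z => Complex.exp (Complex.I * ((inner ℝ a z.1 : ℝ) : ℂ)) *
      (Real.exp (-r * (z.2 : ℝ) ^ 2) : ℂ))
    (by fun_prop) 1 (fun z => by
      rw [norm_mul, mul_comm Complex.I, Complex.norm_exp_ofReal_mul_I, one_mul,
        Complex.norm_of_nonneg (Real.exp_pos _).le]
      exact Real.exp_le_one_iff.mpr (by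
        have : (0 : ℝ) ≤ r * (z.2 : ℝ) ^ 2 := by positivity
        linarith))

lemma expFun_apply (a : EuclideanSpace ℝ (Fin d)) (r : NNReal)
    (z : EuclideanSpace ℝ (Fin d) × NNReal) :
    expFun a r z = Complex.exp (Complex.I * ((inner ℝ a z.1 : ℝ) : ℂ)) *
      (Real.exp (-r * (z.2 : ℝ) ^ 2) : ℂ) := rfl

lemma expFun_mul (a b : EuclideanSpace ℝ (Fin d)) (r s : NNReal) :
    expFun a r * expFun b s = expFun (a + b) (r + s) := by
  ext z
  simp only [BoundedContinuousFunction.mul_apply, expFun_apply, inner_add_left,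
    Complex.ofReal_exp]
  simp only [← Complex.exp_add]
  congr 1
  push_cast
  ring

lemma star_expFun (a : EuclideanSpace ℝ (Fin d)) (r : NNReal) :
    star (expFun a r) = expFun (-a) r := by
  ext z
  rw [BoundedContinuousFunction.star_apply, expFun_apply, expFun_apply, star_mul', RCLike.star_def,
    ← Complex.exp_conj, map_mul, Complex.conj_I, Complex.conj_ofReal, Complex.conj_ofReal,
    inner_neg_left]
  push_cast
  ring_nf

lemma expFun_zero : expFun (0 : EuclideanSpace ℝ (Fin d)) 0 = 1 := by
  ext z; simp [expFun_apply]

/-- The functions `expFun` separate points. -/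
lemma exists_expFun_ne {z w : EuclideanSpace ℝ (Fin d) × NNReal} (h : z ≠ w) :
    ∃ a r, expFun a r z ≠ expFun a r w := by
  by_cases h2 : z.2 = w.2
  · have h1 : z.1 - w.1 ≠ 0 := fun h1 => h (Prod.ext (sub_eq_zero.mp h1) h2)
    refine ⟨(‖z.1 - w.1‖ ^ 2)⁻¹ • (z.1 - w.1), 0, fun heq => ?_⟩
    simp only [expFun_apply, NNReal.coe_zero, neg_zero, zero_mul, Real.exp_zero,
      Complex.ofReal_one, mul_one] at heq
    obtain ⟨n, hn⟩ := Complex.exp_eq_exp_iff_exists_int.mp heq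
    -- with this frequency the phases at `z` and `w` differ by `1`, not a multiple of `2π`
    have hinner : inner ℝ ((‖z.1 - w.1‖ ^ 2)⁻¹ • (z.1 - w.1)) (z.1 - w.1) = 1 := by
      rw [real_inner_smul_left, real_inner_self_eq_norm_sq]
      exact inv_mul_cancel₀ (pow_ne_zero _ (norm_ne_zero_iff.mpr h1))
    have him := congrArg Complex.im hn
    simp at him
    rw [inner_sub_right] at hinner
    have hn1 : (n : ℝ) * (2 * Real.pi) = 1 := by linarith
    have hpi := Real.pi_gt_three
    have h0 : (0 : ℝ) < n := by
      by_contra hcon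
      nlinarith [not_lt.mp hcon]
    have h1' : (1 : ℝ) ≤ n := by exact_mod_cast h0
    nlinarith
  · -- `r ↦ exp (-r²)` is injective on the closed half-line
    refine ⟨0, 1, fun heq => h2 ?_⟩
    simp only [expFun_apply, inner_zero_left, Complex.ofReal_zero, mul_zero, Complex.exp_zero,
      one_mul, NNReal.coe_one] at heq
    have h3 := Real.exp_injective (Complex.ofReal_injective heq)
    have h4 : (z.2 : ℝ) ^ 2 = (w.2 : ℝ) ^ 2 := by linarith
    exact NNReal.coe_injective ((sq_eq_sq₀ z.2.2 w.2.2).mp h4)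

/-- A finite measure on the closed half-space is determined by its integrals against `expFun`. -/
lemma ext_of_integral_expFun {P Q : Measure (EuclideanSpace ℝ (Fin d) × NNReal)}
    [IsFiniteMeasure P] [IsFiniteMeasure Q]
    (h : ∀ a r, ∫ z, expFun a r z ∂P = ∫ z, expFun a r z ∂Q) : P = Q := by
  let s : Set (BoundedContinuousFunction (EuclideanSpace ℝ (Fin d) × NNReal) ℂ) :=
    range fun q : EuclideanSpace ℝ (Fin d) × NNReal => expFun q.1 q.2
  refine ext_of_forall_mem_subalgebra_integral_eq_of_polish (𝕜 := ℂ)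
    (A := StarAlgebra.adjoin ℂ s) (fun z w hzw => ?_) (fun g hg => ?_)
  · obtain ⟨a, r, har⟩ := exists_expFun_ne hzw
    exact ⟨expFun a r, ⟨_, ⟨expFun a r, StarAlgebra.subset_adjoin ℂ s ⟨(a, r), rfl⟩, rfl⟩, rfl⟩,
      har⟩
  · have hg' : g ∈ Submodule.span ℂ (Submonoid.closure (s ∪ star s) : Set _) := by
      rw [← StarAlgebra.adjoin_eq_span]; exact hg
    induction hg' using Submodule.span_induction with
    | mem x hx =>
      have hx' : ∃ a r, x = expFun a r := by
        clear hg
        induction hx using Submonoid.closure_induction with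
        | mem x hx =>
          rcases hx with ⟨q, rfl⟩ | ⟨q, hq⟩
          · exact ⟨_, _, rfl⟩
          · refine ⟨-q.1, q.2, ?_⟩
            rw [← star_expFun, ← star_star x]
            exact congrArg star hq.symm
        | one => exact ⟨0, 0, expFun_zero.symm⟩
        | mul x y _ _ hx hy =>
          obtain ⟨a, r, rfl⟩ := hx
          obtain ⟨b, t, rfl⟩ := hy
          exact ⟨_, _, expFun_mul a b r t⟩
      obtain ⟨a, r, rfl⟩ := hx'
      exact h a r
    | zero => simp
    | add x y hx hy ihx ihy =>
      have mem (z) (hz : z ∈ Submodule.span ℂ (Submonoid.closure (s ∪ star s) : Set _)) :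
          z ∈ StarAlgebra.adjoin ℂ s := by
        rw [← StarAlgebra.adjoin_eq_span] at hz; exact hz
      simp only [BoundedContinuousFunction.coe_add, Pi.add_apply]
      rw [integral_add (x.integrable _) (y.integrable _),
        integral_add (x.integrable _) (y.integrable _), ihx (mem x hx), ihy (mem y hy)]
    | smul c x hx ihx =>
      have mem : x ∈ StarAlgebra.adjoin ℂ s := by
        rw [← StarAlgebra.adjoin_eq_span] at hx; exact hx
      simp only [BoundedContinuousFunction.coe_smul]
      rw [integral_smul, integral_smul, ihx mem]

/-- The modulus of `testFun a 1`. -/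
def gaussianWeight (x : Space d) : ℝ := Real.exp (-‖x.1‖ ^ 2 / 2) * Real.exp (-x.2 ^ 2)

lemma testFun_eq_gaussianWeight_mul (a : EuclideanSpace ℝ (Fin d)) (r : NNReal) {x : Space d}
    (hx : 0 < x.2) :
    testFun a (r + 1) x = (gaussianWeight x : ℂ) * expFun a r (x.1, x.2.toNNReal) := by
  rw [testFun, gaussianWeight, expFun_apply, Real.coe_toNNReal _ hx.le]
  simp only [Complex.ofReal_mul, Complex.ofReal_exp]
  simp only [← Complex.exp_add]
  congr 1
  push_cast
  ring

/-- The positive and the negative part of `f`, weighted by `gaussianWeight`, define finite measures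
with the same integrals against `expFun`. -/
lemma ae_eq_zero_of_integral_mul_testFun_real {f : Space d → ℝ}
    (hf : Integrable (fun x => f x * gaussianWeight x) (mu d α))
    (h : ∀ (a : EuclideanSpace ℝ (Fin d)) (s : ℝ), 0 < s →
      ∫ x, (f x : ℂ) * testFun a s x ∂(mu d α) = 0) : f =ᵐ[mu d α] 0 := by
  set g : Space d → ℝ := fun x => f x * gaussianWeight x with hg
  let T : Space d → EuclideanSpace ℝ (Fin d) × NNReal := fun x => (x.1, x.2.toNNReal)
  let T' : EuclideanSpace ℝ (Fin d) × NNReal → Space d := fun z => (z.1, (z.2 : ℝ))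
  have hT : Measurable T := by fun_prop
  have hT' : Measurable T' := by fun_prop
  let D : (Space d → ℝ) → Measure (Space d) := fun g =>
    (mu d α).withDensity fun x => ENNReal.ofReal (g x)
  have hfin (g : Space d → ℝ) (hg : Integrable g (mu d α)) : IsFiniteMeasure (D g) :=
    isFiniteMeasure_withDensity_ofReal hg.2
  have hD (g : Space d → ℝ) (hg : Integrable g (mu d α)) (a r) :
      ∫ z, expFun a r z ∂((D g).map T) =
        ∫ x, ((max (g x) 0 : ℝ) : ℂ) * expFun a r (T x) ∂(mu d α) := by
    rw [integral_map hT.aemeasurable (expFun a r).continuous.aestronglyMeasurable]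
    simp only [D]
    rw [integral_withDensity_eq_integral_toReal_smul₀ hg.1.aemeasurable.ennreal_ofReal
      (Eventually.of_forall fun _ => ENNReal.ofReal_lt_top)]
    refine integral_congr_ae (Eventually.of_forall fun x => ?_)
    simp only [ENNReal.toReal_ofReal', Complex.real_smul]
  -- transporting back along `T'` recovers a measure carried by the half-space
  have hback (g : Space d → ℝ) : ((D g).map T).map T' = D g := by
    rw [Measure.map_map hT' hT]
    have : T' ∘ T =ᵐ[D g] id := by
      refine (withDensity_absolutelyContinuous _ _).ae_le ?_
      filter_upwards [ae_mem_halfSpace d α] with x hx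
      simp [T, T', Real.coe_toNNReal _ hx.le]
    rw [Measure.map_congr this, Measure.map_id]
  have hint (g : Space d → ℝ) (hg : Integrable g (mu d α)) (a r) :
      Integrable (fun x => ((g x : ℝ) : ℂ) * expFun a r (T x)) (mu d α) := by
    refine hg.ofReal.mul_bdd (c := ‖expFun a r‖) ?_
      (Eventually.of_forall fun x => (expFun a r).norm_coe_le_norm _)
    exact ((expFun a r).continuous.measurable.comp hT).aestronglyMeasurable
  have : IsFiniteMeasure (D g) := hfin g hf
  have : IsFiniteMeasure (D (-g)) := hfin (-g) hf.neg
  have hPQ : (D g).map T = (D (-g)).map T := by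
    refine ext_of_integral_expFun fun a r => ?_
    rw [hD g hf, hD (-g) hf.neg, ← sub_eq_zero, ← integral_sub (hint _ hf.pos_part a r)
      (hint _ hf.neg.pos_part a r)]
    rw [← h a (r + 1) (by positivity)]
    refine integral_congr_ae ?_
    filter_upwards [ae_mem_halfSpace d α] with x hx
    rw [testFun_eq_gaussianWeight_mul a r hx, ← sub_mul, ← Complex.ofReal_sub, Pi.neg_apply,
      max_zero_sub_max_neg_zero_eq_self, hg]
    push_cast
    ring
  have hDD : D g = D (-g) := by rw [← hback g, hPQ, hback]
  have hae := (withDensity_eq_iff hf.1.aemeasurable.ennreal_ofReal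
    hf.neg.1.aemeasurable.ennreal_ofReal hf.lintegral_lt_top.ne).mp hDD
  filter_upwards [hae] with x hx
  have hγ : 0 < gaussianWeight x := by unfold gaussianWeight; positivity
  have h0 : g x = 0 := by
    have h1 := congrArg ENNReal.toReal hx
    rw [ENNReal.toReal_ofReal', ENNReal.toReal_ofReal', Pi.neg_apply] at h1
    rw [← max_zero_sub_max_neg_zero_eq_self (g x), h1, sub_self]
  exact (mul_eq_zero.mp h0).resolve_right hγ.ne'

/-- A function that is orthogonal to all test functions vanishes almost everywhere. -/
lemma ae_eq_zero_of_integral_mul_testFun {f : Space d → ℂ}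
    (hf : ∀ (a : EuclideanSpace ℝ (Fin d)) (s : ℝ), 0 < s →
      Integrable (fun x => f x * testFun a s x) (mu d α))
    (h : ∀ (a : EuclideanSpace ℝ (Fin d)) (s : ℝ), 0 < s →
      ∫ x, f x * testFun a s x ∂(mu d α) = 0) : f =ᵐ[mu d α] 0 := by
  have hw (x : Space d) : testFun 0 1 x = (gaussianWeight x : ℂ) := by
    rw [testFun, gaussianWeight]
    push_cast
    rw [inner_zero_left]
    congr 2
    · push_cast; ring
    · ring
  have hconj (a : EuclideanSpace ℝ (Fin d)) (s : ℝ) (x : Space d) :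
      (starRingEnd ℂ) (f x) * testFun a s x = (starRingEnd ℂ) (f x * testFun (-a) s x) := by
    rw [map_mul, conj_testFun, neg_neg]
  have hci (a : EuclideanSpace ℝ (Fin d)) (s : ℝ) (hs : 0 < s) :
      Integrable (fun x => (starRingEnd ℂ) (f x) * testFun a s x) (mu d α) := by
    simp_rw [hconj]
    exact Complex.conjCLE.integrable_comp_iff.mpr (hf (-a) s hs)
  have hc (a : EuclideanSpace ℝ (Fin d)) (s : ℝ) (hs : 0 < s) :
      ∫ x, (starRingEnd ℂ) (f x) * testFun a s x ∂(mu d α) = 0 := by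
    simp_rw [hconj]
    rw [integral_conj, h (-a) s hs, map_zero]
  have hre : (fun x => (f x).re) =ᵐ[mu d α] 0 := by
    refine ae_eq_zero_of_integral_mul_testFun_real ?_ fun a s hs => ?_
    · refine (hf 0 1 one_pos).re.congr (Eventually.of_forall fun x => ?_)
      simp [hw]
    · have e (x : Space d) : (((f x).re : ℝ) : ℂ) * testFun a s x =
          (2⁻¹ : ℂ) * (f x * testFun a s x + (starRingEnd ℂ) (f x) * testFun a s x) := by
        rw [Complex.re_eq_add_conj]; ring
      simp_rw [e]
      rw [integral_const_mul, integral_add (hf a s hs) (hci a s hs), h a s hs, hc a s hs]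
      simp
  have him : (fun x => (f x).im) =ᵐ[mu d α] 0 := by
    refine ae_eq_zero_of_integral_mul_testFun_real ?_ fun a s hs => ?_
    · refine (hf 0 1 one_pos).im.congr (Eventually.of_forall fun x => ?_)
      simp [hw]
    · have e (x : Space d) : (((f x).im : ℝ) : ℂ) * testFun a s x =
          ((2 * Complex.I)⁻¹ : ℂ) *
            (f x * testFun a s x - (starRingEnd ℂ) (f x) * testFun a s x) := by
        rw [Complex.im_eq_sub_conj]; ring
      simp_rw [e]
      rw [integral_const_mul, integral_sub (hf a s hs) (hci a s hs), h a s hs, hc a s hs]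
      simp
  filter_upwards [hre, him] with x h1 h2
  exact Complex.ext h1 h2

/-! ### Lebesgue norms and Hölder's inequality -/

section General

variable {X : Type*} [MeasurableSpace X] {m : Measure X}

lemma integrable_star {f : X → ℂ} (hf : Integrable f m) : Integrable (star f) m :=
  Complex.conjCLE.integrable_comp_iff.mpr hf

lemma memLp_of_integrable_of_bound {f : X → ℂ} (hf : Integrable f m) {C : ℝ}
    (hC : ∀ x, ‖f x‖ ≤ C) {p : ℝ≥0∞} (hp : 1 ≤ p) : MemLp f p m := by
  rcases eq_or_ne p ∞ with rfl | hp'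
  · exact memLp_top_of_bound hf.1 C (Eventually.of_forall hC)
  have hr : 1 ≤ p.toReal := by
    simpa using ENNReal.toReal_mono hp' hp
  rw [← integrable_norm_rpow_iff hf.1 (one_pos.trans_le hp).ne' hp']
  refine (hf.norm.const_mul (C ^ (p.toReal - 1))).mono'
    (hf.1.norm.aemeasurable.pow_const _).aestronglyMeasurable (Eventually.of_forall fun x => ?_)
  rw [Real.norm_of_nonneg (by positivity)]
  rcases (norm_nonneg (f x)).eq_or_lt with h0 | h0
  · rw [← h0, Real.zero_rpow (by linarith)]; simp
  · calc ‖f x‖ ^ p.toReal = ‖f x‖ ^ (p.toReal - 1) * ‖f x‖ := by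
          rw [← Real.rpow_add_one h0.ne']; ring_nf
      _ ≤ C ^ (p.toReal - 1) * ‖f x‖ := mul_le_mul_of_nonneg_right
          (Real.rpow_le_rpow (norm_nonneg _) (hC x) (by linarith)) (norm_nonneg _)

lemma enorm_integral_mul_le {p q : ℝ≥0∞} [ENNReal.HolderConjugate p q] {f g : X → ℂ}
    (hf : AEStronglyMeasurable f m) (hg : AEStronglyMeasurable g m) :
    ‖∫ x, f x * g x ∂m‖ₑ ≤ eLpNorm f p m * eLpNorm g q m := by
  refine (enorm_integral_le_lintegral_enorm _).trans ?_
  have h := eLpNorm_smul_le_mul_eLpNorm (p := p) (q := q) (r := 1) (f := g) (φ := f) hg hf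
  rwa [eLpNorm_one_eq_lintegral_enorm] at h

lemma tendsto_integral_mul {p q : ℝ≥0∞} [ENNReal.HolderConjugate p q] {u : ℕ → X → ℂ}
    {f g : X → ℂ} (hu : ∀ n, AEStronglyMeasurable (u n) m) (hf : MemLp f p m) (hg : MemLp g q m)
    (h : Tendsto (fun n => eLpNorm (u n - f) p m) atTop (𝓝 0)) :
    Tendsto (fun n => ∫ x, u n x * g x ∂m) atTop (𝓝 (∫ x, f x * g x ∂m)) := by
  rw [tendsto_iff_edist_tendsto_0]
  have h0 : Tendsto (fun n => eLpNorm (u n - f) p m * eLpNorm g q m) atTop (𝓝 0) := by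
    simpa using ENNReal.Tendsto.mul_const h (Or.inr hg.2.ne)
  refine tendsto_of_tendsto_of_tendsto_of_le_of_le' tendsto_const_nhds h0
    (Eventually.of_forall fun n => zero_le) ?_
  filter_upwards [h.eventually (gt_mem_nhds ENNReal.zero_lt_top)] with n hn
  have hd : MemLp (u n - f) p m := ⟨(hu n).sub hf.1, hn⟩
  have hn : MemLp (u n) p m := by simpa using hd.add hf
  have e : (∫ x, u n x * g x ∂m) - ∫ x, f x * g x ∂m = ∫ x, (u n - f) x * g x ∂m := by
    simp_rw [Pi.sub_apply, sub_mul]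
    exact (integral_sub (hn.integrable_mul hg) (hf.integrable_mul hg)).symm
  rw [edist_eq_enorm_sub, e]
  exact enorm_integral_mul_le hd.1 hg.1

lemma eLpNorm_two_eq_of_integral_mul_conj_eq {f g : X → ℂ} (hf : MemLp f 2 m) (hg : MemLp g 2 m)
    (h : ∫ x, f x * (starRingEnd ℂ) (f x) ∂m = ∫ x, g x * (starRingEnd ℂ) (g x) ∂m) :
    eLpNorm f 2 m = eLpNorm g 2 m := by
  rw [hf.eLpNorm_eq_integral_rpow_norm two_ne_zero ENNReal.ofNat_ne_top,
    hg.eLpNorm_eq_integral_rpow_norm two_ne_zero ENNReal.ofNat_ne_top]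
  simp_rw [Complex.mul_conj, Complex.normSq_eq_norm_sq] at h
  rw [integral_complex_ofReal, integral_complex_ofReal, Complex.ofReal_inj] at h
  simp only [ENNReal.toReal_ofNat, Real.rpow_two]
  rw [h]

/-- Log-convexity of the Lebesgue norms: a function bounded by `M` whose square has integral at
most `M` has `L^q`-norm at most `M ^ (1 / p)` for `q ≥ 2`. -/
lemma eLpNorm_le_rpow_of_bound_of_two {p q : ℝ≥0∞} [ENNReal.HolderConjugate p q] (hp : p ≤ 2)
    {g : X → ℂ} (hg : AEStronglyMeasurable g m) {M : ℝ≥0∞}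
    (hM : ∀ x, ‖g x‖ₑ ≤ M) (h2 : eLpNorm g 2 m ≤ M ^ (1 / 2 : ℝ)) :
    eLpNorm g q m ≤ M ^ (1 / p.toReal) := by
  -- `q = ∞` means `p = 1`, where the bound is the hypothesis
  rcases eq_or_ne q ∞ with rfl | hq
  · have : p = 1 := ENNReal.HolderConjugate.unique ∞ p 1
    subst this
    simp only [ENNReal.toReal_one, div_one, ENNReal.rpow_one]
    exact eLpNorm_exponent_top (μ := m) (f := g) ▸
      eLpNormEssSup_le_of_ae_enorm_bound (Eventually.of_forall hM)
  have hp' : p ≠ ∞ := ne_top_of_le_ne_top ENNReal.ofNat_ne_top hp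
  have hpq := ENNReal.HolderConjugate.toReal_of_ne_top hp' hq
  have hp2 : p.toReal ≤ 2 := by simpa using ENNReal.toReal_mono ENNReal.ofNat_ne_top hp
  -- the conjugate of an exponent in `(1, 2]` is at least `2`
  have hr2 : 2 ≤ q.toReal := by
    rw [hpq.conjugate_eq, le_div_iff₀ hpq.sub_one_pos]
    linarith
  have hq0 : q ≠ 0 := by rintro rfl; norm_num at hr2
  rw [eLpNorm_eq_lintegral_rpow_enorm_toReal hq0 hq]
  rw [eLpNorm_eq_lintegral_rpow_enorm_toReal two_ne_zero ENNReal.ofNat_ne_top,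
    ENNReal.toReal_ofNat, ENNReal.rpow_le_rpow_iff (by norm_num)] at h2
  have h3 : ∫⁻ x, ‖g x‖ₑ ^ q.toReal ∂m ≤ M ^ (q.toReal - 1) := by
    calc ∫⁻ x, ‖g x‖ₑ ^ q.toReal ∂m
        ≤ ∫⁻ x, M ^ (q.toReal - 2) * ‖g x‖ₑ ^ (2 : ℝ) ∂m := by
          refine lintegral_mono fun x => ?_
          calc ‖g x‖ₑ ^ q.toReal = ‖g x‖ₑ ^ (q.toReal - 2) * ‖g x‖ₑ ^ (2 : ℝ) := by
                rw [← ENNReal.rpow_add_of_nonneg _ _ (by linarith) (by norm_num), sub_add_cancel]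
            _ ≤ M ^ (q.toReal - 2) * ‖g x‖ₑ ^ (2 : ℝ) :=
              mul_le_mul_left (ENNReal.rpow_le_rpow (hM x) (by linarith)) _
      _ = M ^ (q.toReal - 2) * ∫⁻ x, ‖g x‖ₑ ^ (2 : ℝ) ∂m :=
          lintegral_const_mul'' _ (hg.enorm.pow_const _)
      _ ≤ M ^ (q.toReal - 2) * M := by gcongr
      _ = M ^ (q.toReal - 2) * M ^ (1 : ℝ) := by rw [ENNReal.rpow_one]
      _ = M ^ (q.toReal - 1) := by
          rw [← ENNReal.rpow_add_of_nonneg _ _ (by linarith) (by norm_num)]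
          ring_nf
  calc (∫⁻ x, ‖g x‖ₑ ^ q.toReal ∂m) ^ (1 / q.toReal)
      ≤ (M ^ (q.toReal - 1)) ^ (1 / q.toReal) := by gcongr
    _ = M ^ (1 / p.toReal) := by
        rw [← ENNReal.rpow_mul]
        congr 1
        have := hpq.inv_add_inv_eq_one
        have : q.toReal ≠ 0 := by linarith
        rw [sub_mul, mul_one_div_cancel this]
        simp only [one_div, one_mul]
        linarith

end General

/-! ### The transform of integrable functions -/

lemma norm_kernel_le_one (hα : -(1 / 2 : ℝ) < α) (x y : Space d) : ‖kernel d α x y‖ ≤ 1 := by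
  rw [kernel, norm_mul, neg_mul, mul_comm Complex.I, ← neg_mul, ← Complex.ofReal_neg,
    Complex.norm_exp_ofReal_mul_I, one_mul, Complex.norm_real]
  exact abs_besselj_le_one hα _

lemma continuous_kernel (hα : -(1 / 2 : ℝ) < α) :
    Continuous fun z : Space d × Space d => kernel d α z.1 z.2 := by
  unfold kernel
  have := continuous_besselj hα
  fun_prop

lemma kernel_comm (x y : Space d) : kernel d α x y = kernel d α y x := by
  rw [kernel, kernel, real_inner_comm, mul_comm x.2]

lemma integrable_mul_kernel (hα : -(1 / 2 : ℝ) < α) {f : Space d → ℂ}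
    (hf : Integrable f (mu d α)) (y : Space d) :
    Integrable (fun x => f x * kernel d α x y) (mu d α) :=
  hf.mul_bdd (c := 1)
    ((continuous_kernel hα).comp (by fun_prop : Continuous fun x => (x, y))).aestronglyMeasurable
    (Eventually.of_forall fun x => norm_kernel_le_one hα x y)

lemma norm_transform_le (hα : -(1 / 2 : ℝ) < α) {f : Space d → ℂ}
    (hf : Integrable f (mu d α)) (y : Space d) :
    ‖transform d α f y‖ ≤ ∫ x, ‖f x‖ ∂(mu d α) := by
  refine norm_integral_le_of_norm_le hf.norm (Eventually.of_forall fun x => ?_)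
  rw [norm_mul]
  exact mul_le_of_le_one_right (norm_nonneg _) (norm_kernel_le_one hα x y)

lemma continuous_transform (hα : -(1 / 2 : ℝ) < α) {f : Space d → ℂ}
    (hf : Integrable f (mu d α)) : Continuous (transform d α f) := by
  refine continuous_of_dominated (bound := fun x => ‖f x‖)
    (fun y => (integrable_mul_kernel hα hf y).1)
    (fun y => Eventually.of_forall fun x => ?_) hf.norm (Eventually.of_forall fun x => ?_)
  · rw [norm_mul]
    exact mul_le_of_le_one_right (norm_nonneg _) (norm_kernel_le_one hα x y)
  · have hk : Continuous fun y => kernel d α x y := by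
      unfold kernel
      have := continuous_besselj hα
      fun_prop
    exact continuous_const.mul hk

/-- The multiplication formula for the Weinstein transform. -/
lemma integral_transform_mul (hα : -(1 / 2 : ℝ) < α) {f g : Space d → ℂ}
    (hf : Integrable f (mu d α)) (hg : Integrable g (mu d α)) :
    ∫ y, transform d α f y * g y ∂(mu d α) = ∫ x, f x * transform d α g x ∂(mu d α) := by
  have hint : Integrable (fun z : Space d × Space d => f z.1 * g z.2 * kernel d α z.1 z.2)
      ((mu d α).prod (mu d α)) := by
    have h := Integrable.mul_prod hf hg
    have hk : AEStronglyMeasurable (fun z : Space d × Space d => kernel d α z.1 z.2)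
      ((mu d α).prod (mu d α)) := (continuous_kernel hα).aestronglyMeasurable
    have hb : ∀ᵐ z ∂((mu d α).prod (mu d α)), ‖kernel d α z.1 z.2‖ ≤ 1 :=
      Eventually.of_forall fun z => norm_kernel_le_one hα z.1 z.2
    exact h.mul_bdd hk hb
  have h1 (y : Space d) : transform d α f y * g y =
      ∫ x, f x * g y * kernel d α x y ∂(mu d α) := by
    rw [transform, ← integral_mul_const]
    exact integral_congr_ae (Eventually.of_forall fun x => by simp only; ring)
  have h2 (x : Space d) : f x * transform d α g x =
      ∫ y, f x * g y * kernel d α x y ∂(mu d α) := by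
    rw [transform, ← integral_const_mul]
    exact integral_congr_ae (Eventually.of_forall fun y => by
      simp only; rw [kernel_comm y x]; ring)
  simp_rw [h1, h2]
  exact (integral_integral_swap hint).symm

lemma transform_add (hα : -(1 / 2 : ℝ) < α) {f g : Space d → ℂ} (hf : Integrable f (mu d α))
    (hg : Integrable g (mu d α)) :
    transform d α (f + g) = transform d α f + transform d α g := by
  funext y
  simp only [transform, Pi.add_apply, add_mul]
  exact integral_add (integrable_mul_kernel hα hf y) (integrable_mul_kernel hα hg y)

lemma transform_smul (c : ℂ) (f : Space d → ℂ) :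
    transform d α (c • f) = c • transform d α f := by
  funext y
  simp only [transform, Pi.smul_apply, smul_eq_mul, mul_assoc]
  exact integral_const_mul _ _

/-! ### The transform on square-integrable functions -/

/-- The space of integrable functions `v` with integrable transform that satisfy the inversion
formula `conj (F (conj (F v))) = v` everywhere; conjugating twice replaces the kernel by its
conjugate. -/
def inversionSpace (d : ℕ) {α : ℝ} (hα : -(1 / 2 : ℝ) < α) : Submodule ℂ (Space d → ℂ) where
  carrier := {v | Integrable v (mu d α) ∧ Integrable (transform d α v) (mu d α) ∧
    transform d α (star (transform d α v)) = star v}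
  zero_mem' := by
    have h : transform d α 0 = 0 := by funext y; simp [transform]
    refine ⟨integrable_zero _ _ _, ?_, ?_⟩
    · rw [h]; exact integrable_zero _ _ _
    · rw [h, star_zero, h]
  add_mem' := by
    rintro v w ⟨hv, hFv, hv'⟩ ⟨hw, hFw, hw'⟩
    refine ⟨hv.add hw, ?_, ?_⟩
    · rw [transform_add hα hv hw]; exact hFv.add hFw
    · rw [transform_add hα hv hw, star_add,
        transform_add hα (integrable_star hFv) (integrable_star hFw), hv', hw', star_add]
  smul_mem' := by
    rintro c v ⟨hv, hFv, hv'⟩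
    refine ⟨hv.smul c, ?_, ?_⟩
    · rw [transform_smul]; exact hFv.smul c
    · rw [transform_smul, star_smul, transform_smul, hv', star_smul]

lemma testFun_mem_inversionSpace (hα : -(1 / 2 : ℝ) < α)
    (a : EuclideanSpace ℝ (Fin d)) {s : ℝ} (hs : 0 < s) :
    testFun a s ∈ inversionSpace d hα := by
  have h : transform d α (testFun a s) = fun y => (testDual α a s y : ℂ) :=
    funext fun y => transform_testFun hα a hs y
  refine ⟨integrable_testFun hα a hs, ?_, ?_⟩
  · rw [h]; exact integrable_testDual hα a hs
  · have h' : star (transform d α (testFun a s)) = fun y => (testDual α a s y : ℂ) := by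
      rw [h]; funext y; simp [Pi.star_apply]
    rw [h']
    funext y
    rw [transform_testDual hα a hs, Pi.star_apply, RCLike.star_def, conj_testFun]

lemma memLp_transform_of_mem_inversionSpace (hα : -(1 / 2 : ℝ) < α)
    {v : Space d → ℂ} (hv : v ∈ inversionSpace d hα)
    {p : ℝ≥0∞} (hp : 1 ≤ p) : MemLp (transform d α v) p (mu d α) :=
  memLp_of_integrable_of_bound hv.2.1 (norm_transform_le hα hv.1) hp

lemma memLp_of_mem_inversionSpace (hα : -(1 / 2 : ℝ) < α)
    {v : Space d → ℂ} (hv : v ∈ inversionSpace d hα)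
    {p : ℝ≥0∞} (hp : 1 ≤ p) : MemLp v p (mu d α) := by
  refine memLp_of_integrable_of_bound hv.1
    (C := ∫ y, ‖star (transform d α v) y‖ ∂(mu d α)) (fun x => ?_) hp
  have h := norm_transform_le hα (integrable_star hv.2.1) x
  rwa [hv.2.2, Pi.star_apply, norm_star] at h

/-- The transform preserves the `L²`-norm on `inversionSpace`: this is the multiplication formula
for `v` and `conj (F v)`. -/
lemma eLpNorm_transform_of_mem_inversionSpace (hα : -(1 / 2 : ℝ) < α)
    {v : Space d → ℂ} (hv : v ∈ inversionSpace d hα) :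
    eLpNorm (transform d α v) 2 (mu d α) = eLpNorm v 2 (mu d α) := by
  refine eLpNorm_two_eq_of_integral_mul_conj_eq
    (memLp_transform_of_mem_inversionSpace hα hv one_le_two)
    (memLp_of_mem_inversionSpace hα hv one_le_two) ?_
  have h := integral_transform_mul hα hv.1 (integrable_star hv.2.1)
  rw [hv.2.2] at h
  exact h

/-- The functions of `inversionSpace` are dense in `L²`, because they contain the test functions. -/
lemma exists_inversionSpace_tendsto (hα : -(1 / 2 : ℝ) < α)
    {f : Space d → ℂ} (hf : MemLp f 2 (mu d α)) :
    ∃ v : ℕ → Space d → ℂ, (∀ n, v n ∈ inversionSpace d hα) ∧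
      Tendsto (fun n => eLpNorm (v n - f) 2 (mu d α)) atTop (𝓝 0) := by
  let K : Submodule ℂ (Lp ℂ 2 (mu d α)) :=
    { carrier := {u | ∃ v ∈ inversionSpace d hα, u =ᵐ[mu d α] v}
      zero_mem' := ⟨0, Submodule.zero_mem _, Lp.coeFn_zero _ _ _⟩
      add_mem' := by
        rintro u u' ⟨v, hv, h⟩ ⟨v', hv', h'⟩
        exact ⟨v + v', Submodule.add_mem _ hv hv', (Lp.coeFn_add u u').trans (h.add h')⟩
      smul_mem' := by
        rintro c u ⟨v, hv, h⟩
        exact ⟨c • v, Submodule.smul_mem _ c hv, (Lp.coeFn_smul c u).trans (h.const_smul c)⟩ }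
  have hK : Kᗮ = ⊥ := by
    rw [Submodule.eq_bot_iff]
    intro u hu
    refine Lp.eq_zero_iff_ae_eq_zero.mpr ?_
    have hmem (a : EuclideanSpace ℝ (Fin d)) (s : ℝ) (hs : 0 < s) :
        MemLp (testFun a s) 2 (mu d α) :=
      memLp_of_mem_inversionSpace hα (testFun_mem_inversionSpace hα a hs) one_le_two
    refine ae_eq_zero_of_integral_mul_testFun (α := α) (fun a s hs => ?_) fun a s hs => ?_
    · exact (Lp.memLp u).integrable_mul (hmem a s hs)
    · have h := (Submodule.mem_orthogonal K u).mp hu ((hmem (-a) s hs).toLp _)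
        ⟨_, testFun_mem_inversionSpace hα (-a) hs, MemLp.coeFn_toLp _⟩
      rw [L2.inner_def] at h
      rw [← h]
      refine integral_congr_ae ?_
      filter_upwards [(hmem (-a) s hs).coeFn_toLp] with x hx
      rw [hx, RCLike.inner_apply, conj_testFun, neg_neg]
  have hcl : hf.toLp f ∈ closure (K : Set (Lp ℂ 2 (mu d α))) := by
    rw [← Submodule.topologicalClosure_coe, Submodule.topologicalClosure_eq_top_iff.mpr hK]
    trivial
  obtain ⟨w, hwK, hw⟩ := mem_closure_iff_seq_limit.mp hcl
  choose v hv hwv using hwK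
  refine ⟨v, hv, ?_⟩
  have h := tendsto_iff_edist_tendsto_0.mp hw
  refine h.congr fun n => ?_
  rw [Lp.edist_def]
  exact eLpNorm_congr_ae ((hwv n).sub hf.coeFn_toLp)

/-- The `L²` bound for the Weinstein transform on `L¹ ∩ L²`. -/
lemma eLpNorm_transform_two_le (hα : -(1 / 2 : ℝ) < α)
    {f : Space d → ℂ} (hf : Integrable f (mu d α))
    (hf2 : MemLp f 2 (mu d α)) :
    eLpNorm (transform d α f) 2 (mu d α) ≤ eLpNorm f 2 (mu d α) := by
  obtain ⟨v, hv, hvf⟩ := exists_inversionSpace_tendsto hα hf2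
  have hv2 (n) := memLp_of_mem_inversionSpace hα (hv n) one_le_two
  have hF2 (n) := memLp_transform_of_mem_inversionSpace hα (hv n) one_le_two
  -- the transforms of an approximating sequence are Cauchy in `L²`; their limit is `F f`,
  -- as the multiplication formula shows by testing both against the Gaussians
  let A : ℕ → Lp ℂ 2 (mu d α) := fun n => (hv2 n).toLp
  let B : ℕ → Lp ℂ 2 (mu d α) := fun n => (hF2 n).toLp
  have hA : Tendsto A atTop (𝓝 (hf2.toLp f)) := by
    rw [tendsto_iff_edist_tendsto_0]
    refine hvf.congr fun n => ?_
    rw [Lp.edist_toLp_toLp]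
  have hdist (n k : ℕ) : edist (B n) (B k) = edist (A n) (A k) := by
    have hsub : v n - v k ∈ inversionSpace d hα := Submodule.sub_mem _ (hv n) (hv k)
    have e : transform d α (v n - v k) = transform d α (v n) - transform d α (v k) := by
      rw [sub_eq_add_neg, ← neg_one_smul ℂ (v k), transform_add hα (hv n).1 ((hv k).1.smul _),
        transform_smul, neg_one_smul, ← sub_eq_add_neg]
    rw [Lp.edist_toLp_toLp, Lp.edist_toLp_toLp, ← e,
      eLpNorm_transform_of_mem_inversionSpace hα hsub]
  have hB : CauchySeq B := by
    have := hA.cauchySeq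
    rw [EMetric.cauchySeq_iff] at this ⊢
    simpa only [hdist] using this
  obtain ⟨g, hg⟩ := cauchySeq_tendsto_of_complete hB
  have hBg : Tendsto (fun n => eLpNorm (transform d α (v n) - (g : Space d → ℂ)) 2 (mu d α))
      atTop (𝓝 0) := by
    refine (tendsto_iff_edist_tendsto_0.mp hg).congr fun n => ?_
    rw [Lp.edist_def]
    exact eLpNorm_congr_ae ((hF2 n).coeFn_toLp.sub (ae_eq_refl _))
  have hfg : transform d α f =ᵐ[mu d α] g := by
    have hb (a : EuclideanSpace ℝ (Fin d)) (s : ℝ) (hs : 0 < s) :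
        Integrable (fun y => transform d α f y * testFun a s y) (mu d α) :=
      (integrable_testFun hα a hs).bdd_mul (continuous_transform hα hf).aestronglyMeasurable
        (Eventually.of_forall (norm_transform_le hα hf))
    have ht (a : EuclideanSpace ℝ (Fin d)) (s : ℝ) (hs : 0 < s) : MemLp (testFun a s) 2 (mu d α) :=
      memLp_of_mem_inversionSpace hα (testFun_mem_inversionSpace hα a hs) one_le_two
    have hgi (a : EuclideanSpace ℝ (Fin d)) (s : ℝ) (hs : 0 < s) :
        Integrable (fun y => g y * testFun a s y) (mu d α) :=
      (Lp.memLp g).integrable_mul (ht a s hs)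
    have h0 : (fun y => transform d α f y - g y) =ᵐ[mu d α] 0 := by
      refine ae_eq_zero_of_integral_mul_testFun (α := α) (fun a s hs => ?_) fun a s hs => ?_
      · simp_rw [sub_mul]; exact (hb a s hs).sub (hgi a s hs)
      · simp_rw [sub_mul]
        rw [integral_sub (hb a s hs) (hgi a s hs), sub_eq_zero,
          integral_transform_mul hα hf (integrable_testFun hα a hs)]
        refine tendsto_nhds_unique (tendsto_integral_mul (p := 2) (q := 2)
          (fun n => (hv2 n).1) hf2 (memLp_transform_of_mem_inversionSpace hα
            (testFun_mem_inversionSpace hα a hs) one_le_two) hvf) ?_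
        refine (tendsto_integral_mul (p := 2) (q := 2) (fun n => (hF2 n).1) (Lp.memLp g)
          (ht a s hs) hBg).congr fun n => ?_
        exact integral_transform_mul hα (hv n).1 (integrable_testFun hα a hs)
    filter_upwards [h0] with y hy using sub_eq_zero.mp hy
  rw [eLpNorm_congr_ae hfg]
  refine le_of_eq ?_
  have h1 : Tendsto (fun n => ‖B n‖ₑ) atTop (𝓝 ‖g‖ₑ) := hg.enorm
  have h2 : Tendsto (fun n => ‖A n‖ₑ) atTop (𝓝 ‖hf2.toLp f‖ₑ) := hA.enorm
  have h3 : ‖g‖ₑ = ‖hf2.toLp f‖ₑ := by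
    refine tendsto_nhds_unique h1 (h2.congr fun n => ?_)
    rw [Lp.enorm_toLp, Lp.enorm_toLp, eLpNorm_transform_of_mem_inversionSpace hα (hv n)]
  rwa [Lp.enorm_toLp, Lp.enorm_def] at h3

/-- The transform of a function bounded by the indicator of `S`: its `L^q`-norm is controlled by
interpolating between the `L²` and the `L^∞` bound. -/
lemma eLpNorm_transform_indicator_le (hα : -(1 / 2 : ℝ) < α)
    {p q : ℝ≥0∞} [ENNReal.HolderConjugate p q] (hp : p ≤ 2)
    {S : Set (Space d)} (hS : MeasurableSet S) (hS' : mu d α S ≠ ∞) {k : Space d → ℂ}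
    (hkm : AEStronglyMeasurable k (mu d α)) (hk : ∀ x, ‖k x‖ ≤ 1) :
    Integrable (S.indicator k) (mu d α) ∧
      eLpNorm (transform d α (S.indicator k)) q (mu d α) ≤ mu d α S ^ (1 / p.toReal) := by
  have hle (r : ℝ≥0∞) : eLpNorm (S.indicator k) r (mu d α) ≤
      eLpNorm (S.indicator fun _ => (1 : ℂ)) r (mu d α) := by
    refine eLpNorm_mono fun x => ?_
    by_cases hx : x ∈ S <;> simp [hx, hk x]
  have hm := hkm.indicator hS
  have h1 : eLpNorm (S.indicator k) 1 (mu d α) ≤ mu d α S := by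
    refine (hle 1).trans ?_
    rw [eLpNorm_indicator_const hS one_ne_zero ENNReal.one_ne_top]
    simp
  have h2 : eLpNorm (S.indicator k) 2 (mu d α) ≤ mu d α S ^ (1 / 2 : ℝ) := by
    refine (hle 2).trans ?_
    rw [eLpNorm_indicator_const hS two_ne_zero ENNReal.ofNat_ne_top]
    simp
  have hint : Integrable (S.indicator k) (mu d α) :=
    memLp_one_iff_integrable.mp ⟨hm, h1.trans_lt hS'.lt_top⟩
  refine ⟨hint, eLpNorm_le_rpow_of_bound_of_two hp
    (continuous_transform hα hint).aestronglyMeasurable (fun y => ?_)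
    ((eLpNorm_transform_two_le hα hint ⟨hm, h2.trans_lt (by finiteness)⟩).trans h2)⟩
  refine le_trans ?_ h1
  rw [eLpNorm_one_eq_lintegral_enorm, transform]
  refine (enorm_integral_le_lintegral_enorm _).trans (lintegral_mono fun x => ?_)
  rw [enorm_mul]
  refine mul_le_of_le_one_right' ?_
  rw [← ofReal_norm]
  exact ENNReal.ofReal_le_one.mpr (norm_kernel_le_one hα x y)

/-! ### Inversion and the bound for bandlimited functions -/

/-- The multiplication formula for the extension of the transform to `L^p`. -/
lemma IsTransform.integral_mul (hα : -(1 / 2 : ℝ) < α) {p : ℝ≥0∞} (hp : 1 ≤ p)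
    {f g w : Space d → ℂ} (hfg : IsTransform d α p f g) (hw : Integrable w (mu d α))
    (hwp : MemLp w p (mu d α))
    (hFw : MemLp (transform d α w) (ENNReal.conjExponent p) (mu d α)) :
    ∫ y, g y * w y ∂(mu d α) = ∫ x, f x * transform d α w x ∂(mu d α) := by
  have := ENNReal.HolderConjugate.conjExponent hp
  obtain ⟨hf, hg, u, hu, huf, hug⟩ := hfg
  have hu1 (n) : Integrable (u n) (mu d α) := memLp_one_iff_integrable.mp (hu n).1
  refine tendsto_nhds_unique (tendsto_integral_mul (p := ENNReal.conjExponent p) (q := p)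
    (fun n => (continuous_transform hα (hu1 n)).aestronglyMeasurable) hg hwp hug) ?_
  refine (tendsto_integral_mul (p := p) (q := ENNReal.conjExponent p)
    (fun n => (hu1 n).1) hf hFw huf).congr fun n => ?_
  exact (integral_transform_mul hα (hu1 n) hw).symm

/-- Fourier inversion in `L^p` when the transform is integrable. -/
lemma IsTransform.ae_eq_of_integrable (hα : -(1 / 2 : ℝ) < α) {p : ℝ≥0∞} (hp : 1 ≤ p)
    {f g : Space d → ℂ} (hfg : IsTransform d α p f g) (hg : Integrable g (mu d α)) :
    f =ᵐ[mu d α] star (transform d α (star g)) := by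
  have hpq := ENNReal.HolderConjugate.conjExponent hp
  have hq : 1 ≤ ENNReal.conjExponent p := ENNReal.HolderConjugate.one_le _ p
  have hgs := integrable_star hg
  have hf (a : EuclideanSpace ℝ (Fin d)) (s : ℝ) (hs : 0 < s) :
      Integrable (fun x => f x * testFun a s x) (mu d α) :=
    hfg.1.integrable_mul (q := ENNReal.conjExponent p) (memLp_of_mem_inversionSpace hα
      (testFun_mem_inversionSpace hα a hs) hq)
  have hF (a : EuclideanSpace ℝ (Fin d)) (s : ℝ) (hs : 0 < s) :
      Integrable (fun x => star (transform d α (star g)) x * testFun a s x) (mu d α) := by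
    refine (integrable_testFun hα a hs).bdd_mul
      (continuous_star.comp (continuous_transform hα hgs)).aestronglyMeasurable
        (c := ∫ x, ‖star g x‖ ∂(mu d α)) (Eventually.of_forall fun x => ?_)
    rw [Pi.star_apply, norm_star]
    exact norm_transform_le hα hgs x
  have h0 : (fun x => f x - star (transform d α (star g)) x) =ᵐ[mu d α] 0 := by
    refine ae_eq_zero_of_integral_mul_testFun (α := α) (fun a s hs => ?_) fun a s hs => ?_
    · simp_rw [sub_mul]; exact (hf a s hs).sub (hF a s hs)
    simp_rw [sub_mul]
    rw [integral_sub (hf a s hs) (hF a s hs), sub_eq_zero]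
    -- both integrals equal the integral of `g` against `testDual α (-a) s`
    have hD := integrable_testDual hα (-a) hs
    have hFD : transform d α (fun x => (testDual α (-a) s x : ℂ)) = testFun a s := by
      funext y; rw [transform_testDual hα (-a) hs, neg_neg]
    have h1 := hfg.integral_mul hα hp hD
      (memLp_of_integrable_of_bound hD (norm_testDual_le α (-a) hs) hp) (by
        rw [hFD]
        exact memLp_of_mem_inversionSpace hα (testFun_mem_inversionSpace hα a hs) hq)
    rw [hFD] at h1
    rw [← h1]
    have h2 := congrArg (starRingEnd ℂ)
      (integral_transform_mul hα hgs (integrable_testFun hα (-a) hs))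
    rw [← integral_conj, ← integral_conj] at h2
    simp_rw [map_mul, conj_testFun, neg_neg, transform_testFun hα (-a) hs, Complex.conj_ofReal,
      Pi.star_apply, RCLike.star_def, Complex.conj_conj] at h2
    exact h2.symm
  filter_upwards [h0] with x hx using sub_eq_zero.mp hx

/-- A function of `L^p` whose transform is carried by a set of finite measure is bounded. The
constant comes from representing its values as integrals against transforms of functions bounded
by the indicator of that set, so the Hausdorff–Young inequality is not needed. -/
lemma IsTransform.ae_enorm_le (hα : -(1 / 2 : ℝ) < α) {p : ℝ≥0∞} (hp1 : 1 ≤ p) (hp2 : p ≤ 2)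
    {S : Set (Space d)} (hS : MeasurableSet S) (hS' : mu d α S ≠ ∞) {ψ g : Space d → ℂ}
    (h : IsTransform d α p ψ (S.indicator g)) :
    ∀ᵐ x ∂(mu d α), ‖ψ x‖ₑ ≤ mu d α S ^ (1 / p.toReal) * eLpNorm ψ p (mu d α) := by
  have hpq := ENNReal.HolderConjugate.conjExponent hp1
  have hint : Integrable (S.indicator g) (mu d α) := by
    have h1 : Integrable (fun x => S.indicator g x * S.indicator (fun _ => (1 : ℂ)) x) (mu d α) :=
      h.2.1.integrable_mul (q := p) (memLp_indicator_const p hS 1 (Or.inr hS'))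
    refine h1.congr (Eventually.of_forall fun x => ?_)
    by_cases hx : x ∈ S <;> simp [hx]
  filter_upwards [h.ae_eq_of_integrable hα hp1 hint] with x hx
  let k : Space d → ℂ := fun y => (starRingEnd ℂ) (kernel d α y x)
  have hkc : Continuous k := by
    have := continuous_besselj hα
    simp only [k]
    unfold kernel
    fun_prop
  obtain ⟨hki, hkq⟩ := eLpNorm_transform_indicator_le (q := ENNReal.conjExponent p) hα hp2 hS hS'
    hkc.aestronglyMeasurable (fun y => by
      simp only [k]; rw [RCLike.norm_conj]; exact norm_kernel_le_one hα y x)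
  have hkp : MemLp (S.indicator k) p (mu d α) := by
    refine memLp_of_integrable_of_bound hki (C := 1) (fun y => ?_) hp1
    by_cases hy : y ∈ S
    · simp only [hy, indicator_of_mem, k, RCLike.norm_conj]; exact norm_kernel_le_one hα y x
    · simp [hy]
  have hkF : MemLp (transform d α (S.indicator k)) (ENNReal.conjExponent p) (mu d α) :=
    ⟨(continuous_transform hα hki).aestronglyMeasurable, hkq.trans_lt (by finiteness)⟩
  have key := h.integral_mul hα hp1 hki hkp hkF
  have e : star (transform d α (star (S.indicator g))) x =
      ∫ y, S.indicator g y * S.indicator k y ∂(mu d α) := by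
    rw [Pi.star_apply, transform, RCLike.star_def, ← integral_conj]
    refine integral_congr_ae (Eventually.of_forall fun y => ?_)
    by_cases hy : y ∈ S <;> simp [hy, k]
  rw [hx, e, key, mul_comm]
  exact (enorm_integral_mul_le h.1.1 hkF.1).trans (by gcongr)

/-- The mass on `Ω` of a function bandlimited to `S`. -/
lemma IsBandlimited.eLpNorm_indicator_le (hα : -(1 / 2 : ℝ) < α) {p : ℝ≥0∞} (hp1 : 1 ≤ p)
    (hp2 : p ≤ 2) {Ω S : Set (Space d)} (hΩ : MeasurableSet Ω) (hS : MeasurableSet S)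
    {ψ : Space d → ℂ} (hψ : IsBandlimited d α p S ψ) :
    eLpNorm (Ω.indicator ψ) p (mu d α) ≤
      mu d α S ^ (1 / p.toReal) * mu d α Ω ^ (1 / p.toReal) * eLpNorm ψ p (mu d α) := by
  obtain ⟨g, -, hg⟩ := hψ
  have hp' : 0 < 1 / p.toReal := by
    have := ENNReal.toReal_pos (one_pos.trans_le hp1).ne'
      (ne_top_of_le_ne_top ENNReal.ofNat_ne_top hp2)
    positivity
  rw [eLpNorm_indicator_eq_eLpNorm_restrict hΩ]
  -- for `mu S = ∞` the right-hand side is infinite unless one of its other factors vanishes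
  by_cases hS' : mu d α S = ∞
  · rcases eq_or_ne (mu d α Ω) 0 with h0 | h0
    · rw [Measure.restrict_eq_zero.mpr h0, eLpNorm_measure_zero]
      exact zero_le
    rcases eq_or_ne (eLpNorm ψ p (mu d α)) 0 with h1 | h1
    · rw [h1, mul_zero, ← h1]
      exact eLpNorm_mono_measure _ Measure.restrict_le_self
    · rw [hS', ENNReal.top_rpow_of_pos hp', ENNReal.top_mul, ENNReal.top_mul h1]
      · exact le_top
      · exact (ENNReal.rpow_pos_of_nonneg (pos_iff_ne_zero.mpr h0) hp'.le).ne'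
  · refine (eLpNorm_le_of_ae_enorm_bound
      (ae_restrict_of_ae (hg.ae_enorm_le hα hp1 hp2 hS hS'))).trans (le_of_eq ?_)
    rw [Measure.restrict_apply_univ, smul_eq_mul, one_div]
    ring

end Weinstein

end

theorem theoremD (d : ℕ) (α : ℝ) (hα : -(1 / 2 : ℝ) < α)
    (p : ℝ≥0∞) (hp1 : 1 ≤ p) (hp2 : p ≤ 2)
    (Ω S : Set (Weinstein.Space d))
    (hΩ : MeasurableSet Ω) (hΩ_sub : Ω ⊆ Weinstein.halfSpace d)
    (hS : MeasurableSet S) (hS_sub : S ⊆ Weinstein.halfSpace d)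
    (φ : Weinstein.Space d → ℂ)
    (hφ : MemLp φ p (Weinstein.mu d α)) (hφ_ne : ¬ φ =ᵐ[Weinstein.mu d α] 0)
    (εΩ εS : ℝ)
    (hconc : Weinstein.IsConcentrated d α p Ω εΩ φ)
    (hband : Weinstein.IsEpsBandlimited d α p S εS φ) :
    ENNReal.ofReal (1 - εΩ - εS) ≤
      ENNReal.ofReal (1 + εS) * Weinstein.mu d α S ^ (1 / p.toReal) *
        Weinstein.mu d α Ω ^ (1 / p.toReal) := by
  obtain ⟨ψ, hψ, hφψ⟩ := hband
  have hψp : MemLp ψ p (Weinstein.mu d α) := by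
    obtain ⟨g, hg, -⟩ := hψ; exact hg.1
  have hbound := hψ.eLpNorm_indicator_le hα hp1 hp2 hΩ hS
  unfold Weinstein.IsConcentrated Weinstein.timeLimit at hconc
  unfold Weinstein.norm at hconc hφψ
  have hp0 : p ≠ 0 := (one_pos.trans_le hp1).ne'
  set N := eLpNorm φ p (Weinstein.mu d α)
  have hN0 : N ≠ 0 := fun h => hφ_ne ((eLpNorm_eq_zero_iff hφ.1 hp0).mp h)
  have hNt : N ≠ ∞ := hφ.2.ne
  have hNpos : 0 < N.toReal := ENNReal.toReal_pos hN0 hφ.2.ne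
  have hεΩ : 0 ≤ εΩ := nonneg_of_mul_nonneg_left (ENNReal.toReal_nonneg.trans hconc) hNpos
  have hεS : 0 ≤ εS := nonneg_of_mul_nonneg_left (ENNReal.toReal_nonneg.trans hφψ) hNpos
  have h1 : eLpNorm (φ - Ω.indicator φ) p (Weinstein.mu d α) ≤ ENNReal.ofReal εΩ * N := by
    rw [← ENNReal.ofReal_toReal hNt, ← ENNReal.ofReal_mul hεΩ]
    exact (ENNReal.le_ofReal_iff_toReal_le (hφ.sub (hφ.indicator hΩ)).2.ne (by positivity)).mpr
      hconc
  have h2 : eLpNorm (φ - ψ) p (Weinstein.mu d α) ≤ ENNReal.ofReal εS * N := by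
    rw [← ENNReal.ofReal_toReal hNt, ← ENNReal.ofReal_mul hεS]
    exact (ENNReal.le_ofReal_iff_toReal_le (hφ.sub hψp).2.ne (by positivity)).mpr hφψ
  have h3 : eLpNorm ψ p (Weinstein.mu d α) ≤ ENNReal.ofReal (1 + εS) * N := by
    have e : ψ = φ - (φ - ψ) := by abel
    rw [e]
    refine (eLpNorm_sub_le hφ.1 (hφ.sub hψp).1 hp1).trans ?_
    rw [ENNReal.ofReal_add zero_le_one hεS, add_mul, ENNReal.ofReal_one, one_mul]
    gcongr
  have h4 : N ≤ ENNReal.ofReal εΩ * N + ENNReal.ofReal εS * N +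
      eLpNorm (Ω.indicator ψ) p (Weinstein.mu d α) := by
    have e : φ = (φ - Ω.indicator φ) + Ω.indicator (φ - ψ) + Ω.indicator ψ := by
      rw [Set.indicator_sub']; abel
    have hA := hφ.sub (hφ.indicator hΩ)
    have hB := (hφ.sub hψp).indicator hΩ
    calc N = eLpNorm ((φ - Ω.indicator φ) + Ω.indicator (φ - ψ) + Ω.indicator ψ) p
          (Weinstein.mu d α) := by rw [← e]
      _ ≤ eLpNorm (φ - Ω.indicator φ) p (Weinstein.mu d α) +
          eLpNorm (Ω.indicator (φ - ψ)) p (Weinstein.mu d α) +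
          eLpNorm (Ω.indicator ψ) p (Weinstein.mu d α) :=
        (eLpNorm_add_le (hA.add hB).1 (hψp.indicator hΩ).1 hp1).trans
          (by gcongr; exact eLpNorm_add_le hA.1 hB.1 hp1)
      _ ≤ _ := by
        gcongr
        exact (eLpNorm_indicator_le _).trans h2
  rw [← ENNReal.mul_le_mul_iff_left hN0 hφ.2.ne]
  calc ENNReal.ofReal (1 - εΩ - εS) * N
      = N - (ENNReal.ofReal εΩ * N + ENNReal.ofReal εS * N) := by
        rw [sub_sub, ENNReal.ofReal_sub _ (add_nonneg hεΩ hεS), ENNReal.ofReal_add hεΩ hεS,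
          ENNReal.ofReal_one, ENNReal.sub_mul (fun _ _ => hφ.2.ne), one_mul, add_mul]
    _ ≤ eLpNorm (Ω.indicator ψ) p (Weinstein.mu d α) := tsub_le_iff_left.mpr h4
    _ ≤ _ := hbound
    _ ≤ Weinstein.mu d α S ^ (1 / p.toReal) * Weinstein.mu d α Ω ^ (1 / p.toReal) *
        (ENNReal.ofReal (1 + εS) * N) := by gcongr
    _ = _ := by ring
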